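/- Let $(X,\Sigma,\mu)$ be a Lebesgue space with normalized continuous measure, i.e. a measure space isomorphic mod $0$ to $[0,1]$ with Lebesgue measure. Let $\mathcal A$ be the group of invertible measure-preserving transformations of $X$, where transformations that coincide mod $0$ are identified. Let $(A_i)_{i\ge 1}$ be a sequence in $\Sigma$ such that the finite linear combinations of the constant function $1$ and of the indicators $\mathbf 1_{A_i}$ approximate the indicator of every measurable set in $L^1(\mu)$ (for instance, a sequence that is dense in the measure algebra of $\mu$, or one that enumerates a family closed under finite intersections and generating $\Sigma$ mod $0$). For $T,S\in\mathcal A$ put $$d(T,S)=\sum_{i}2^{-i}\bigl(\mu(TA_i\bigtriangleup SA_i)+\mu(T^{-1}A_i\bigtriangleup S^{-1}A_i)\bigr),\qquad a(T,S)=\sum_{i,j}2^{-i-j}\bigl|\mu(TA_i\cap A_j)-\mu(SA_i\cap A_j)\bigr|.$$ Let $\mathcal G$ be a countable group, and let $(|g|)_{g\in\mathcal G}$ be positive real numbers with $\sum_{g\in\mathcal G}2^{-|g|}<\infty$. A $\mathcal G$-action is a homomorphism $T:\mathcal G\to\mathcal A$, $g\mapsto T^g$; it is mixing if $\mu(T^gB\cap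 C)\to\mu(B)\mu(C)$ as $|g|\to\infty$ for all $B,C\in\Sigma$. Let $\mathcal M_{\mathcal G}$ be the set of mixing $\mathcal G$-actions, and for $T,S\in\mathcal M_{\mathcal G}$ put $$m(T,S)=\sum_{g\in\mathcal G}2^{-|g|}d(T^g,S^g)+\sup_{g\in\mathcal G}a(T^g,S^g).$$ Then $m$ is a (finite-valued) metric on $\mathcal M_{\mathcal G}$, and $(\mathcal M_{\mathcal G},m)$ is a complete separable metric space. -/

import Mathlib

open MeasureTheory Filter Topology
open scoped ENNReal

namespace LeadMetric

/-- `f` is a measure-preserving map of `(X, μ)` to `(Y, ν)`, where "measurable" refers to the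
completed σ-algebras. -/
def NullMeasurePreserving {X Y : Type*} [MeasurableSpace X] [MeasurableSpace Y]
    (f : X → Y) (μ : Measure X) (ν : Measure Y) : Prop :=
  ∀ B : Set Y, NullMeasurableSet B ν → NullMeasurableSet (f ⁻¹' B) μ ∧ μ (f ⁻¹' B) = ν B

/-- `(X, μ)` is a (normalized, continuous) Lebesgue space: it is isomorphic mod 0 to the unit
interval with Lebesgue measure.  Both standard Borel spaces and complete measure spaces in the
sense of Rokhlin are covered. -/
def IsLebesgueSpace {X : Type*} [MeasurableSpace X] (μ : Measure X) : Prop :=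
  ∃ (f : X → unitInterval) (g : unitInterval → X),
    NullMeasurePreserving f μ volume ∧ NullMeasurePreserving g volume μ ∧
    (∀ᵐ x ∂μ, g (f x) = x) ∧ (∀ᵐ t : unitInterval, f (g t) = t)

/-- The sequence of measurable sets `A i` is total: finite linear combinations of the
constant `1` and of the indicators of the `A i` approximate the indicator of every measurable
set in `L¹`. -/
def IsTotalSequence {X : Type*} [MeasurableSpace X] (μ : Measure X) (A : ℕ → Set X) : Prop :=
  (∀ i, MeasurableSet (A i)) ∧
  ∀ B : Set X, MeasurableSet B → ∀ ε : ℝ, 0 < ε →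
    ∃ (s : Finset ℕ) (c₀ : ℝ) (c : ℕ → ℝ),
      ∫ x, |B.indicator (fun _ => (1 : ℝ)) x
        - (c₀ + ∑ i ∈ s, c i * (A i).indicator (fun _ => (1 : ℝ)) x)| ∂μ < ε

section Aut

variable {X : Type*} [MeasurableSpace X]

theorem NullMeasurePreserving.comp {f g : X → X} {μ : Measure X}
    (hg : NullMeasurePreserving g μ μ) (hf : NullMeasurePreserving f μ μ) :
    NullMeasurePreserving (g ∘ f) μ μ := fun B hB =>
  ⟨(hf _ (hg B hB).1).1, (hf _ (hg B hB).1).2.trans (hg B hB).2⟩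

theorem NullMeasurePreserving.ae {f : X → X} {μ : Measure X}
    (hf : NullMeasurePreserving f μ μ) {p : X → Prop} (hp : ∀ᵐ x ∂μ, p x) :
    ∀ᵐ x ∂μ, p (f x) := by
  have h0 : μ {x | ¬ p x} = 0 := hp
  have h1 := (hf {x | ¬ p x} (NullMeasurableSet.of_null h0)).2
  rw [h0] at h1
  exact h1

/-- The group of invertible measure-preserving transformations of `(X, μ)`, before
identification mod 0. -/
def invertibleTransformations (μ : Measure X) : Subgroup (Equiv.Perm X) where
  carrier := {e | NullMeasurePreserving e μ μ ∧ NullMeasurePreserving e.symm μ μ}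
  one_mem' := ⟨fun _ hB => ⟨hB, rfl⟩, fun _ hB => ⟨hB, rfl⟩⟩
  mul_mem' := fun ha hb => ⟨ha.1.comp hb.1, hb.2.comp ha.2⟩
  inv_mem' := fun ha => ⟨ha.2, ha.1⟩

/-- The transformations that coincide with the identity mod 0. -/
def trivialTransformations (μ : Measure X) : Subgroup (invertibleTransformations μ) where
  carrier := {e | ∀ᵐ x ∂μ, e.1 x = x}
  one_mem' := by
    change ∀ᵐ x ∂μ, x = x
    exact Eventually.of_forall fun _ => rfl
  mul_mem' := by
    intro a b ha hb
    change ∀ᵐ x ∂μ, a.1 (b.1 x) = x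
    filter_upwards [ha, hb] with x hx hy
    rw [hy, hx]
  inv_mem' := by
    intro a ha
    change ∀ᵐ x ∂μ, a.1.symm x = x
    filter_upwards [ha] with x hx
    rw [Equiv.symm_apply_eq, hx]

instance (μ : Measure X) : (trivialTransformations μ).Normal where
  conj_mem := by
    intro n hn g
    have h := g.2.2.ae (p := fun x => n.1 x = x) hn
    change ∀ᵐ x ∂μ, g.1 (n.1 (g.1.symm x)) = x
    filter_upwards [h] with x hx
    rw [hx, Equiv.apply_symm_apply]

/-- The group `𝒜` of invertible measure-preserving transformations of `(X, μ)`, where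
transformations that coincide mod 0 are identified. -/
abbrev TransformationGroup (μ : Measure X) : Type _ :=
  invertibleTransformations μ ⧸ trivialTransformations μ

theorem image_ae_eq {μ : Measure X} {e f : invertibleTransformations μ}
    (h : (QuotientGroup.leftRel (trivialTransformations μ)) e f) (B : Set X) :
    (e.1 '' B : Set X) =ᵐ[μ] (f.1 '' B : Set X) := by
  rw [QuotientGroup.leftRel_apply] at h
  have h1 : ∀ᵐ x ∂μ, e.1.symm (f.1 x) = x := h
  have h2 := f.2.2.ae (p := fun x => e.1.symm (f.1 x) = x) h1
  filter_upwards [h2] with x hx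
  rw [Equiv.apply_symm_apply] at hx
  apply propext
  change x ∈ e.1 '' B ↔ x ∈ f.1 '' B
  rw [Equiv.image_eq_preimage_symm, Equiv.image_eq_preimage_symm, Set.mem_preimage,
    Set.mem_preimage, hx]

/-- `μ (T B ∩ C)`. -/
def measureInter {μ : Measure X} (B C : Set X) (T : TransformationGroup μ) : ℝ≥0∞ :=
  Quotient.liftOn' T (fun e => μ ((e.1 '' B) ∩ C)) fun _ _ h =>
    measure_congr ((image_ae_eq h B).inter (ae_eq_refl C))

/-- `μ (T B ∆ S B)`. -/
def measureSymmDiff {μ : Measure X} (B : Set X) (T S : TransformationGroup μ) : ℝ≥0∞ :=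
  Quotient.liftOn₂' T S (fun e f => μ (symmDiff (e.1 '' B) (f.1 '' B))) fun _ _ _ _ h h' =>
    measure_congr ((image_ae_eq h B).symmDiff (image_ae_eq h' B))

/-- The metric `d` on `𝒜`; the sequence is indexed from `0`, so that its `i`-th term has weight
`2 ^ (-(i + 1))`. -/
noncomputable def transDist {μ : Measure X} (A : ℕ → Set X) (T S : TransformationGroup μ) :
    ℝ≥0∞ :=
  ∑' i : ℕ, (1 / 2 : ℝ≥0∞) ^ (i + 1) *
    (measureSymmDiff (A i) T S + measureSymmDiff (A i) T⁻¹ S⁻¹)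

/-- The metric `a` on `𝒜`. -/
noncomputable def transCorr {μ : Measure X} (A : ℕ → Set X) (T S : TransformationGroup μ) :
    ℝ≥0∞ :=
  ∑' (i : ℕ) (j : ℕ), (1 / 2 : ℝ≥0∞) ^ ((i + 1) + (j + 1)) *
    ENNReal.ofReal |(measureInter (A i) (A j) T).toReal - (measureInter (A i) (A j) S).toReal|

variable {G : Type*} [Group G]

/-- The metric `d` on measure-preserving `G`-actions, i.e. on homomorphisms `G → 𝒜`. -/
noncomputable def actionDist {μ : Measure X} (len : G → ℝ) (A : ℕ → Set X)
    (T S : G →* TransformationGroup μ) : ℝ≥0∞ :=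
  ∑' g : G, ENNReal.ofReal ((2 : ℝ) ^ (-len g)) * transDist A (T g) (S g)

/-- The lead metric `m(T, S) = d(T, S) + sup_g a(T^g, S^g)`. -/
noncomputable def leadDist {μ : Measure X} (len : G → ℝ) (A : ℕ → Set X)
    (T S : G →* TransformationGroup μ) : ℝ≥0∞ :=
  actionDist len A T S + ⨆ g : G, transCorr A (T g) (S g)

/-- `T` is mixing: `μ (T^g B ∩ C) → μ B * μ C` as `|g| → ∞`, for all measurable `B`, `C`. -/
def IsMixing {μ : Measure X} (len : G → ℝ) (T : G →* TransformationGroup μ) : Prop :=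
  ∀ B C : Set X, MeasurableSet B → MeasurableSet C →
    Tendsto (fun g => measureInter B C (T g)) (comap len atTop) (𝓝 (μ B * μ C))

end Aut

/-- The set of mixing `G`-actions on `(X, μ)`, identified mod 0. -/
def MixingAction {X : Type*} [MeasurableSpace X] (μ : Measure X) {G : Type*} [Group G]
    (len : G → ℝ) : Type _ :=
  {T : G →* TransformationGroup μ // IsMixing len T}

end LeadMetric

/-! Everything is moved to `L1 μ`. A transformation `T` acts there by the isometry `x ↦ x ∘ T⁻¹`
(`rep`); the terms of `d` become distances between images of indicators, and the terms of `a` become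
differences of matrix coefficients. Both sums are bounded, so `m` is finite. It separates points
because a total sequence determines the operator (`IsTotalSequence.mem_of_isClosed`) and the
operator determines `T` mod 0 (`IsLebesgueSpace.rep_injective`).

Completeness. Along a Cauchy sequence the operators of each `g` converge on the total sequence,
hence, being isometries, on all of `L1 μ`. The limit is again a composition operator
(`IsLebesgueSpace.exists_comp_of_tendsto`): follow the coordinate `f : X → [0,1]` along an a.e.
convergent subsequence. The limits for `g` and `g⁻¹` are mutually inverse, so they come from a
transformation (`IsLebesgueSpace.exists_rep_eq`), and multiplicativity passes to the limit.
Transformations are bijections everywhere, so a map that is invertible only mod 0 is first altered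
on a null set as large as `X`. The supremum in `m` makes correlations converge uniformly in `g`, so
the limit action is mixing.

Separability. Pointwise `L¹` convergence of the operators is a second countable topology and
controls `d`, but controls `a` only at finitely many `g` at once. Mixing handles the rest: outside a
finite `K ⊆ G` the correlations of `T` are `ε`-close to the product values. For the actions sharing
one `K`, a countable pointwise dense subset is `3ε`-dense for `m`, and there are countably many `K`.
-/

namespace LeadMetric

/-! ### Large null sets, and turning mod 0 isomorphisms into bijections. -/

section NullSets

/-- A set of positive measure in a Polish space with a Borel probability measure contains a null
set with the cardinality of the continuum. -/
theorem exists_injection_null_range {Y : Type*} [TopologicalSpace Y] [PolishSpace Y]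
    [MeasurableSpace Y] [BorelSpace Y] (ν : Measure Y) [IsFiniteMeasure ν] [NullSingletonClass ν]
    {s : Set Y} (hs : NullMeasurableSet s ν) (h0 : ν s ≠ 0) :
    ∃ h : (ℕ → Bool) → Y, Function.Injective h ∧ Set.range h ⊆ s ∧ ν (Set.range h) = 0 := by
  obtain ⟨s', hs's, hs'm, hs'e⟩ := hs.exists_measurable_subset_ae_eq
  have h0' : 0 < ν s' := by
    rw [measure_congr hs'e]; exact pos_iff_ne_zero.2 h0
  let := TopologicalSpace.upgradeIsCompletelyMetrizable Y
  obtain ⟨P, hPs, hPc, hP0⟩ := hs'm.exists_lt_isClosed_of_ne_top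
    (measure_ne_top ν s') h0'
  have hPn : ¬ P.Countable := fun h => hP0.ne' (h.measure_zero ν)
  obtain ⟨f, hfP, hfc, hfi⟩ := hPc.exists_nat_bool_injection_of_not_countable hPn
  -- Interleaving two binary sequences splits the Cantor set into continuum many disjoint closed
  -- copies of itself, indexed by the even digits.
  let w : (ℕ → Bool) → (ℕ → Bool) → (ℕ → Bool) := fun a b n =>
    if n % 2 = 0 then a (n / 2) else b (n / 2)
  have hw : ∀ a a' b b', w a b = w a' b' → a = a' ∧ b = b' := by
    intro a a' b b' h
    constructor
    · funext n
      have := congrFun h (2 * n)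
      simpa [w] using this
    · funext n
      have := congrFun h (2 * n + 1)
      have h1 : (2 * n + 1) % 2 = 1 := by omega
      have h2 : (2 * n + 1) / 2 = n := by omega
      simpa [w, h1, h2] using this
  have hwc : ∀ a, Continuous (w a) := by
    intro a
    refine continuous_pi fun n => ?_
    by_cases hn : n % 2 = 0
    · simp only [w, hn, if_true]; exact continuous_const
    · simp only [w, hn, if_false]; exact continuous_apply _
  have hcl : ∀ a, IsClosed (Set.range (f ∘ w a)) := fun a =>
    (isCompact_range (hfc.comp (hwc a))).isClosed
  have hdisj : Pairwise (Function.onFun Disjoint fun a => Set.range (f ∘ w a)) := by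
    intro a a' haa'
    rw [Function.onFun, Set.disjoint_left]
    rintro _ ⟨b, rfl⟩ ⟨b', hb'⟩
    exact haa' (hw _ _ _ _ (hfi hb')).1.symm
  -- Only countably many disjoint sets can have positive measure, so some copy is null.
  have hcount := Measure.countable_meas_pos_of_disjoint_iUnion (μ := ν)
    (fun a => (hcl a).measurableSet) hdisj
  obtain ⟨a, ha⟩ : ∃ a, ¬ 0 < ν (Set.range (f ∘ w a)) := by
    by_contra! hall
    have huniv : {i | 0 < ν (Set.range (f ∘ w i))} = Set.univ := Set.eq_univ_of_forall hall
    rw [huniv, Set.countable_univ_iff] at hcount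
    have hle : Cardinal.mk (ℕ → Bool) ≤ Cardinal.aleph0 := Cardinal.mk_le_aleph0_iff.2 hcount
    have hmk : Cardinal.mk (ℕ → Bool) = Cardinal.continuum := by
      rw [← Cardinal.power_def, Cardinal.mk_bool, Cardinal.mk_nat, Cardinal.two_power_aleph0]
    exact absurd (hmk ▸ hle) Cardinal.aleph0_lt_continuum.not_ge
  refine ⟨f ∘ w a, fun b b' h => (hw _ _ _ _ (hfi h)).2, ?_, by simpa using ha⟩
  rintro _ ⟨b, rfl⟩
  exact hs's (hPs (hfP ⟨_, rfl⟩))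

/-- A bijection between two sets whose complements have the cardinality of the whole space extends
to a permutation. -/
theorem exists_perm_eqOn {X : Type*} {f f' : X → X} {D : Set X}
    (hD : ∀ x ∈ D, f' (f x) = x)
    (h1 : Cardinal.mk X ≤ Cardinal.mk (Dᶜ : Set X))
    (h2 : Cardinal.mk X ≤ Cardinal.mk ((f '' D)ᶜ : Set X)) :
    ∃ e : Equiv.Perm X, ∀ x ∈ D, e x = f x := by
  classical
  have hc : Cardinal.mk (Dᶜ : Set X) = Cardinal.mk ((f '' D)ᶜ : Set X) :=
    le_antisymm ((Cardinal.mk_set_le _).trans h2) ((Cardinal.mk_set_le _).trans h1)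
  obtain ⟨e'⟩ := Cardinal.eq.1 hc
  have hinj : Set.InjOn f D := fun x hx y hy hxy => by
    rw [← hD x hx, ← hD y hy, hxy]
  let e0 : D ≃ f '' D := Equiv.Set.imageOfInjOn f D hinj
  refine ⟨(Equiv.Set.sumCompl D).symm.trans ((Equiv.sumCongr e0 e').trans
    (Equiv.Set.sumCompl (f '' D))), fun x hx => ?_⟩
  simp [Equiv.Set.sumCompl_symm_apply_of_mem hx, e0, Equiv.Set.imageOfInjOn]

variable {X : Type*} [MeasurableSpace X] {μ : Measure X}

/-- A Lebesgue space contains a null set which is equinumerous to the whole space. -/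
theorem IsLebesgueSpace.exists_null_mk_eq (hμ : IsLebesgueSpace μ) :
    ∃ N : Set X, μ N = 0 ∧ Cardinal.mk X ≤ Cardinal.mk N := by
  obtain ⟨f, g, hf, hg, hgf, hfg⟩ := hμ
  obtain ⟨h, hi, hr, h0⟩ := exists_injection_null_range (volume : Measure unitInterval)
    (s := {t | f (g t) = t})
    ((NullMeasurableSet.of_null (s := {t | f (g t) = t}ᶜ) hfg).of_compl) (by
      have : (volume : Measure unitInterval) {t | f (g t) = t} = volume Set.univ :=
        measure_congr (by filter_upwards [hfg] with t ht using eq_true ht)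
      rw [this]; simp)
  have hk : ∀ b, f (g (h b)) = h b := fun b => hr ⟨b, rfl⟩
  -- Off the exceptional set `f` is injective into the interval, so only that set can exceed the
  -- continuum in size. It is null, and a null copy of the Cantor set is added to it.
  refine ⟨{x | g (f x) ≠ x} ∪ Set.range (g ∘ h), ?_, ?_⟩
  · refine measure_union_null hgf (measure_mono_null (t := f ⁻¹' Set.range h) ?_ ?_)
    · rintro _ ⟨b, rfl⟩
      exact ⟨b, (hk b).symm⟩
    · rw [(hf _ (NullMeasurableSet.of_null h0)).2, h0]
  · set N := {x | g (f x) ≠ x} ∪ Set.range (g ∘ h)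
    have hinj : Function.Injective (g ∘ h) := fun b b' hb => hi <| by
      have := congrArg f hb
      simpa only [Function.comp_apply, hk] using this
    have hc : Cardinal.continuum ≤ Cardinal.mk N := by
      have h1 := Cardinal.mk_le_of_injective (α := ULift (ℕ → Bool)) (β := N)
        (f := fun b => ⟨g (h b.down), Or.inr ⟨b.down, rfl⟩⟩) (by
          rintro ⟨b⟩ ⟨b'⟩ hb
          exact congrArg ULift.up (hinj (congrArg Subtype.val hb)))
      simpa using h1
    have hX0 : Cardinal.mk ({x | g (f x) ≠ x}ᶜ : Set X) ≤ Cardinal.continuum := by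
      have h1 := Cardinal.mk_le_of_injective (α := ({x | g (f x) ≠ x}ᶜ : Set X))
        (β := ULift ℝ) (f := fun x => ⟨f x.1⟩) (by
          rintro ⟨x, hx⟩ ⟨y, hy⟩ hxy
          have h2 : f x = f y := Subtype.ext (congrArg ULift.down hxy)
          have hx' : g (f x) = x := not_not.1 hx
          have hy' : g (f y) = y := not_not.1 hy
          exact Subtype.ext (hx'.symm.trans ((congrArg g h2).trans hy')))
      simpa [Cardinal.mk_real] using h1
    calc Cardinal.mk X
        = Cardinal.mk {x | g (f x) ≠ x} + Cardinal.mk ({x | g (f x) ≠ x}ᶜ : Set X) :=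
          (Cardinal.mk_sum_compl _).symm
      _ ≤ Cardinal.mk N + Cardinal.mk N :=
          add_le_add (Cardinal.mk_le_mk_of_subset Set.subset_union_left) (hX0.trans hc)
      _ = Cardinal.mk N := Cardinal.add_eq_self (Cardinal.aleph0_le_continuum.trans hc)

theorem IsLebesgueSpace.isProbabilityMeasure (hμ : IsLebesgueSpace μ) :
    IsProbabilityMeasure μ := by
  obtain ⟨f, -, hf, -⟩ := hμ
  have := (hf Set.univ nullMeasurableSet_univ).2
  exact ⟨by simpa using this⟩

theorem NullMeasurePreserving.congr {f g : X → X} (hf : NullMeasurePreserving f μ μ)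
    (h : f =ᵐ[μ] g) : NullMeasurePreserving g μ μ := fun B hB => by
  have h1 : (f ⁻¹' B : Set X) =ᵐ[μ] (g ⁻¹' B : Set X) := by
    filter_upwards [h] with x hx
    apply propext
    change f x ∈ B ↔ g x ∈ B
    rw [hx]
  exact ⟨(hf B hB).1.congr h1, (measure_congr h1).symm.trans (hf B hB).2⟩

/-- Measure-preserving maps of a Lebesgue space which are inverse to each other mod 0 coincide
mod 0 with a measure-preserving bijection and its inverse. -/
theorem IsLebesgueSpace.exists_invertibleTransformation (hμ : IsLebesgueSpace μ) {f f' : X → X}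
    (hf : NullMeasurePreserving f μ μ) (hf' : NullMeasurePreserving f' μ μ)
    (h : ∀ᵐ x ∂μ, f' (f x) = x) (h' : ∀ᵐ x ∂μ, f (f' x) = x) :
    ∃ e : invertibleTransformations μ, (∀ᵐ x ∂μ, e.1 x = f x) ∧ ∀ᵐ x ∂μ, e.1.symm x = f' x := by
  obtain ⟨N, hN0, hN⟩ := hμ.exists_null_mk_eq
  have hNae : ∀ᵐ x ∂μ, x ∉ N := measure_eq_zero_iff_ae_notMem.1 hN0
  -- Removing `N` and `f ⁻¹' N` leaves `N` inside the complements of both `D` and `f '' D`, which is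
  -- what the extension to a permutation requires.
  set D : Set X := {x | f' (f x) = x ∧ x ∉ N ∧ f x ∉ N}
  have hDae : ∀ᵐ x ∂μ, x ∈ D := by
    filter_upwards [h, hNae, hf.ae hNae] with x h1 h2 h3 using ⟨h1, h2, h3⟩
  obtain ⟨e, he⟩ := exists_perm_eqOn (f := f) (f' := f') (D := D) (fun x hx => hx.1)
    (hN.trans (Cardinal.mk_le_mk_of_subset fun x hx hxD => hxD.2.1 hx))
    (hN.trans (Cardinal.mk_le_mk_of_subset (by
      rintro x hx ⟨y, hy, rfl⟩
      exact hy.2.2 hx)))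
  have he1 : ∀ᵐ x ∂μ, e x = f x := hDae.mono he
  have he2 : ∀ᵐ x ∂μ, e.symm x = f' x := by
    filter_upwards [hf'.ae he1, h'] with x h1 h2
    rw [Equiv.symm_apply_eq, h1, h2]
  exact ⟨⟨e, hf.congr (he1.mono fun x => Eq.symm), hf'.congr (he2.mono fun x => Eq.symm)⟩,
    he1, he2⟩

end NullSets

/-! ### Composition operators on `L¹` of the completed measure. -/

section Koopman

theorem completion_apply' {X : Type*} [MeasurableSpace X] (μ : Measure X)
    (s : Set (NullMeasurableSpace X μ)) :
    μ.completion s = μ (show Set X from s) := Measure.completion_apply μ s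

/-- A null-measurable measure-preserving map is measure-preserving between the completions. -/
theorem NullMeasurePreserving.measurePreserving {X Y : Type*} [MeasurableSpace X]
    [MeasurableSpace Y] {f : X → Y} {μ : Measure X} {ν : Measure Y}
    (hf : NullMeasurePreserving f μ ν) :
    @MeasurePreserving (NullMeasurableSpace X μ) (NullMeasurableSpace Y ν) _ _ f
      μ.completion ν.completion := by
  have hm : @Measurable (NullMeasurableSpace X μ) (NullMeasurableSpace Y ν) _ _ f :=
    fun B hB => (hf B hB).1
  refine ⟨hm, ?_⟩
  ext B hB
  rw [Measure.map_apply hm hB, completion_apply', completion_apply']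
  exact (hf B hB).2

variable {X : Type*} [MeasurableSpace X]

/-- The real `L¹` space of the completion of `μ`. -/
abbrev L1 (μ : Measure X) : Type _ := Lp ℝ 1 μ.completion

variable {μ : Measure X}

instance [IsProbabilityMeasure μ] : IsProbabilityMeasure μ.completion :=
  ⟨(completion_apply' μ _).trans measure_univ⟩

/-- The isometry `x ↦ x ∘ e⁻¹` of `L¹`. -/
noncomputable def koopman (e : invertibleTransformations μ) : L1 μ →ₗᵢ[ℝ] L1 μ :=
  Lp.compMeasurePreservingₗᵢ ℝ (μ := μ.completion) (μb := μ.completion) _ e.2.2.measurePreserving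

theorem coeFn_koopman (e : invertibleTransformations μ) (x : L1 μ) :
    (koopman e x : X → ℝ) =ᵐ[μ] fun t => x (e.1.symm t) :=
  Lp.coeFn_compMeasurePreserving x e.2.2.measurePreserving

theorem L1.coeFn_add (x y : L1 μ) :
    ((x + y : L1 μ) : X → ℝ) =ᵐ[μ] fun t => (x : X → ℝ) t + (y : X → ℝ) t :=
  Lp.coeFn_add x y

theorem L1.coeFn_smul (c : ℝ) (x : L1 μ) :
    ((c • x : L1 μ) : X → ℝ) =ᵐ[μ] fun t => c * (x : X → ℝ) t :=
  Lp.coeFn_smul c x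

theorem L1.coeFn_sum (s : Finset ℕ) (x : ℕ → L1 μ) :
    ((∑ i ∈ s, x i : L1 μ) : X → ℝ) =ᵐ[μ] fun t => ∑ i ∈ s, (x i : X → ℝ) t := by
  have h : ((∑ i ∈ s, x i : L1 μ) : X → ℝ) =ᵐ[μ] ∑ i ∈ s, (x i : X → ℝ) :=
    Lp.coeFn_finsetSum s x
  refine h.trans (Eventually.of_forall fun t => ?_)
  exact Finset.sum_apply t s fun i => (x i : X → ℝ)

/-- The bridge between the two σ-algebras: transformations are measurable only for the completion,
while totality is stated with integrals against `μ`. -/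
theorem measurePreserving_id_completion (μ : Measure X) :
    @MeasurePreserving (NullMeasurableSpace X μ) X _ _ id μ.completion μ := by
  have hm : @Measurable (NullMeasurableSpace X μ) X _ _ id := fun B hB => hB.nullMeasurableSet
  refine ⟨hm, ?_⟩
  ext B hB
  rw [Measure.map_apply hm hB, completion_apply']
  rfl

theorem integral_completion (f : X → ℝ) (hf : AEStronglyMeasurable f μ) :
    @integral (NullMeasurableSpace X μ) ℝ _ _ _ μ.completion f = ∫ x, f x ∂μ := by
  have h := measurePreserving_id_completion μ
  have h1 := integral_map h.measurable.aemeasurable (f := f) (by rwa [h.map_eq])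
  rw [h.map_eq] at h1
  exact h1.symm

theorem dist_L1 (x y : L1 μ) {f g : X → ℝ} (hf : x =ᵐ[μ] f) (hg : y =ᵐ[μ] g)
    (hfg : AEStronglyMeasurable (fun t => |f t - g t|) μ) :
    dist x y = ∫ t, |f t - g t| ∂μ := by
  rw [L1.dist_eq_integral_dist, ← integral_completion _ hfg]
  refine integral_congr_ae ?_
  filter_upwards [hf, hg] with t h1 h2
  rw [h1, h2, Real.dist_eq]

theorem IsTotalSequence.measurableSet {A : ℕ → Set X} (hA : IsTotalSequence μ A) (i : ℕ) :
    MeasurableSet (A i) := hA.1 i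

variable [IsProbabilityMeasure μ]

/-- The class of the indicator of a null-measurable set. -/
noncomputable def indL1 {B : Set X} (hB : NullMeasurableSet B μ) : L1 μ :=
  indicatorConstLp (α := NullMeasurableSpace X μ) (μ := μ.completion) 1 hB (measure_ne_top _ _) 1

theorem coeFn_indL1 {B : Set X} (hB : NullMeasurableSet B μ) :
    (indL1 hB : X → ℝ) =ᵐ[μ] B.indicator fun _ => 1 :=
  indicatorConstLp_coeFn (α := NullMeasurableSpace X μ)

theorem indL1_congr {B C : Set X} (hB : NullMeasurableSet B μ) (hC : NullMeasurableSet C μ)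
    (h : B =ᵐ[μ] C) : indL1 hB = indL1 hC := by
  refine Lp.ext ?_
  refine (coeFn_indL1 hB).trans (EventuallyEq.trans ?_ (coeFn_indL1 hC).symm)
  exact indicator_ae_eq_of_ae_eq_set h

theorem edist_indL1 {B C : Set X} (hB : NullMeasurableSet B μ) (hC : NullMeasurableSet C μ) :
    edist (indL1 hB) (indL1 hC) = μ (symmDiff B C) := by
  refine (edist_indicatorConstLp_eq_enorm (α := NullMeasurableSpace X μ)).trans ?_
  rw [← ofReal_norm, norm_indicatorConstLp one_ne_zero ENNReal.one_ne_top]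
  simp only [norm_one, ENNReal.toReal_one, div_one, Real.rpow_one, one_mul, Measure.real]
  rw [ENNReal.ofReal_toReal (measure_ne_top _ _)]
  exact completion_apply' μ _

/-- The class of the constant function `1`. -/
noncomputable def oneL1 (μ : Measure X) [IsProbabilityMeasure μ] : L1 μ :=
  indL1 (nullMeasurableSet_univ (μ := μ))

theorem coeFn_oneL1 : (oneL1 μ : X → ℝ) =ᵐ[μ] fun _ => 1 := by
  refine (coeFn_indL1 nullMeasurableSet_univ).trans (Eventually.of_forall fun x => ?_)
  simp

/-- Indicators of measurable sets span a dense subspace of `L¹`. -/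
theorem mem_of_isClosed_of_indL1 (K : Submodule ℝ (L1 μ)) (hK : IsClosed (K : Set (L1 μ)))
    (hB : ∀ (B : Set X) (hB : MeasurableSet B), indL1 (μ := μ) hB.nullMeasurableSet ∈ K)
    (x : L1 μ) : x ∈ K := by
  refine Lp.induction ENNReal.one_ne_top (motive := (· ∈ K)) ?_
    (fun f g hf hg _ h1 h2 => K.add_mem h1 h2) hK x
  intro c s hs hμs
  have hs' : @NullMeasurableSet X _ s μ := hs
  obtain ⟨t, -, htm, hts⟩ := hs'.exists_measurable_subset_ae_eq
  have h2 := K.smul_mem c (hB t htm)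
  rw [indL1_congr htm.nullMeasurableSet hs' hts] at h2
  convert h2
  refine Lp.ext ?_
  rw [Lp.simpleFunc.coe_indicatorConst]
  refine (indicatorConstLp_coeFn (α := NullMeasurableSpace X μ)).trans ?_
  filter_upwards [L1.coeFn_smul c (indL1 hs'), coeFn_indL1 hs'] with x h3 h4
  rw [h3, h4]
  change s.indicator (fun _ => c) x = c * s.indicator (fun _ => (1 : ℝ)) x
  by_cases hx : x ∈ s <;> simp [hx]

/-- The form in which totality is used: `K` will be the equalizer of two operators, or the set of
vectors at which a sequence or a family converges. -/
theorem IsTotalSequence.mem_of_isClosed {A : ℕ → Set X} (hA : IsTotalSequence μ A)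
    (K : Submodule ℝ (L1 μ)) (hK : IsClosed (K : Set (L1 μ))) (h1 : oneL1 μ ∈ K)
    (hAK : ∀ i, indL1 (hA.measurableSet i).nullMeasurableSet ∈ K) (x : L1 μ) : x ∈ K := by
  have hB' : ∀ B : Set X, MeasurableSet B → ∀ hB : NullMeasurableSet B μ, indL1 hB ∈ K := by
    intro B hBm hB
    rw [← SetLike.mem_coe, ← hK.closure_eq, Metric.mem_closure_iff]
    intro ε hε
    obtain ⟨s, c₀, c, h⟩ := hA.2 B hBm ε hε
    refine ⟨c₀ • oneL1 μ + ∑ i ∈ s, c i • indL1 (hA.measurableSet i).nullMeasurableSet,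
      K.add_mem (K.smul_mem _ h1) (K.sum_mem fun i _ => K.smul_mem _ (hAK i)), ?_⟩
    rw [dist_L1 (μ := μ) _ _ (coeFn_indL1 hB) (g := fun x => c₀ + ∑ i ∈ s, c i *
      (A i).indicator (fun _ => (1 : ℝ)) x)]
    · exact h
    · have hall : ∀ᵐ t ∂μ, ∀ i, ((c i • indL1 (hA.measurableSet i).nullMeasurableSet : L1 μ) :
          X → ℝ) t = c i * (A i).indicator (fun _ => (1 : ℝ)) t := by
        refine ae_all_iff.2 fun i => ?_
        filter_upwards [L1.coeFn_smul (c i) (indL1 (hA.measurableSet i).nullMeasurableSet),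
          coeFn_indL1 (hA.measurableSet i).nullMeasurableSet] with t h1 h2
        rw [h1, h2]
      filter_upwards [L1.coeFn_add (c₀ • oneL1 μ)
        (∑ i ∈ s, c i • indL1 (hA.measurableSet i).nullMeasurableSet),
        L1.coeFn_smul c₀ (oneL1 μ), coeFn_oneL1 (μ := μ), hall,
        L1.coeFn_sum s fun i => c i • indL1 (hA.measurableSet i).nullMeasurableSet]
        with t h1 h2 h3 h4 h5
      rw [h1, h2, h3, h5, mul_one]
      exact congrArg _ (Finset.sum_congr rfl fun i _ => h4 i)
    · have hm : ∀ i, Measurable ((A i).indicator fun _ => (1 : ℝ)) := fun i =>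
        measurable_const.indicator (hA.measurableSet i)
      have hmB : Measurable (B.indicator fun _ => (1 : ℝ)) := measurable_const.indicator hBm
      have : Measurable fun t => B.indicator (fun _ => (1 : ℝ)) t -
          (c₀ + ∑ i ∈ s, c i * (A i).indicator (fun _ => (1 : ℝ)) t) := by fun_prop
      exact (continuous_abs.measurable.comp this).aestronglyMeasurable
  exact mem_of_isClosed_of_indL1 K hK (fun B hB => hB' B hB hB.nullMeasurableSet) x

theorem koopman_indL1 (e : invertibleTransformations μ) {B : Set X}
    (hB : NullMeasurableSet B μ) (hB' : NullMeasurableSet (e.1 '' B) μ) :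
    koopman e (indL1 hB) = indL1 hB' := by
  refine Lp.ext ?_
  refine (coeFn_koopman e _).trans (EventuallyEq.trans ?_ (coeFn_indL1 hB').symm)
  filter_upwards [e.2.2.ae (coeFn_indL1 hB)] with x hx
  rw [hx]
  rw [Equiv.image_eq_preimage_symm]
  rfl

end Koopman
-- The faithful isometric representation of the transformation group.
section Representation

variable {X : Type*} [MeasurableSpace X] {μ : Measure X}

theorem koopman_congr {e f : invertibleTransformations μ}
    (h : ∀ᵐ x ∂μ, e.1.symm x = f.1.symm x) (x : L1 μ) : koopman e x = koopman f x := by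
  refine Lp.ext ?_
  refine (coeFn_koopman e x).trans (EventuallyEq.trans ?_ (coeFn_koopman f x).symm)
  filter_upwards [h] with t ht
  rw [ht]

theorem koopman_mul (e f : invertibleTransformations μ) (x : L1 μ) :
    koopman (e * f) x = koopman e (koopman f x) := by
  refine Lp.ext ?_
  refine (coeFn_koopman _ x).trans (EventuallyEq.trans ?_ (coeFn_koopman e _).symm)
  filter_upwards [e.2.2.ae (coeFn_koopman f x)] with t ht
  rw [ht]
  rfl

theorem koopman_one (x : L1 μ) : koopman (1 : invertibleTransformations μ) x = x := by
  refine Lp.ext ?_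
  exact coeFn_koopman _ x

theorem mk_eq_mk_iff {e f : invertibleTransformations μ} :
    (e : TransformationGroup μ) = f ↔ ∀ᵐ x ∂μ, e.1.symm x = f.1.symm x := by
  rw [QuotientGroup.eq]
  change (∀ᵐ x ∂μ, e.1.symm (f.1 x) = x) ↔ _
  constructor
  · intro h
    filter_upwards [f.2.2.ae h] with x hx
    rwa [Equiv.apply_symm_apply] at hx
  · intro h
    filter_upwards [f.2.1.ae h] with x hx
    rw [hx, Equiv.symm_apply_apply]

/-- The isometric representation of the transformation group on `L¹`. -/
noncomputable def rep (T : TransformationGroup μ) : L1 μ →ₗᵢ[ℝ] L1 μ :=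
  koopman (Quotient.out T)

theorem rep_mk (e : invertibleTransformations μ) (x : L1 μ) :
    rep (e : TransformationGroup μ) x = koopman e x :=
  koopman_congr (mk_eq_mk_iff.1 (QuotientGroup.out_eq' _)) x

theorem rep_mul (T S : TransformationGroup μ) (x : L1 μ) : rep (T * S) x = rep T (rep S x) := by
  induction T using QuotientGroup.induction_on with | H e
  induction S using QuotientGroup.induction_on with | H f
  rw [rep_mk, rep_mk, ← QuotientGroup.mk_mul, rep_mk, koopman_mul]

theorem rep_one (x : L1 μ) : rep (1 : TransformationGroup μ) x = x := by
  rw [← QuotientGroup.mk_one, rep_mk, koopman_one]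

theorem rep_inv_rep (T : TransformationGroup μ) (x : L1 μ) : rep T⁻¹ (rep T x) = x := by
  rw [← rep_mul, inv_mul_cancel, rep_one]

theorem NullMeasurePreserving.measurePreserving_borel {Y : Type*} [MeasurableSpace Y]
    {ν : Measure Y} {f : X → Y} (hf : NullMeasurePreserving f μ ν) :
    @MeasurePreserving (NullMeasurableSpace X μ) Y _ _ f μ.completion ν :=
  (measurePreserving_id_completion ν).comp hf.measurePreserving

/-- The function `h ∘ f` as an element of `L¹`, for `h` continuous and `f` measure-preserving. -/
noncomputable def compL1 {f : X → unitInterval}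
    (hf : @MeasurePreserving (NullMeasurableSpace X μ) _ _ _ f μ.completion volume)
    (h : C(unitInterval, ℝ)) : L1 μ :=
  Lp.compMeasurePreserving f hf (ContinuousMap.toLp 1 volume ℝ h)

theorem coeFn_compL1 {f : X → unitInterval}
    (hf : @MeasurePreserving (NullMeasurableSpace X μ) _ _ _ f μ.completion volume)
    (h : C(unitInterval, ℝ)) : (compL1 hf h : X → ℝ) =ᵐ[μ] fun x => h (f x) := by
  have h1 : (compL1 hf h : X → ℝ) =ᵐ[μ] fun x =>
      (ContinuousMap.toLp 1 (volume : Measure unitInterval) ℝ h : unitInterval → ℝ) (f x) :=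
    Lp.coeFn_compMeasurePreserving _ hf
  exact h1.trans (hf.quasiMeasurePreserving.ae (ContinuousMap.coeFn_toLp volume h))

/-- The inclusion of the unit interval into the real line. -/
def inclusionMap : C(unitInterval, ℝ) := ⟨Subtype.val, continuous_subtype_val⟩

/-- One vector suffices, the coordinate function `f` viewed as real-valued: its image under the
operator of `T` is `f ∘ T⁻¹`, and `g` recovers `T⁻¹` from it almost everywhere. -/
theorem IsLebesgueSpace.rep_injective (hμ : IsLebesgueSpace μ) {T S : TransformationGroup μ}
    (h : ∀ x, rep T x = rep S x) : T = S := by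
  obtain ⟨f, g, hf, -, hgf, -⟩ := hμ
  induction T using QuotientGroup.induction_on with | H e
  induction S using QuotientGroup.induction_on with | H e'
  have h1 := h (compL1 hf.measurePreserving_borel inclusionMap)
  rw [rep_mk, rep_mk] at h1
  have h2 := coeFn_koopman e (compL1 hf.measurePreserving_borel inclusionMap)
  rw [h1] at h2
  refine mk_eq_mk_iff.2 ?_
  filter_upwards [h2, coeFn_koopman e' (compL1 hf.measurePreserving_borel inclusionMap),
    e.2.2.ae (coeFn_compL1 hf.measurePreserving_borel inclusionMap),
    e'.2.2.ae (coeFn_compL1 hf.measurePreserving_borel inclusionMap),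
    e.2.2.ae hgf, e'.2.2.ae hgf] with t h3 h4 h5 h6 h7 h8
  rw [h4, h5, h6] at h3
  rw [← h7, ← h8, Subtype.ext h3]

/-- The integral over a set as a functional on `L¹`. -/
noncomputable def setIntegralₗ {Y : Type*} [MeasurableSpace Y] (ν : Measure Y) (C : Set Y) :
    Lp ℝ 1 ν →ₗ[ℝ] ℝ where
  toFun x := ∫ t in C, x t ∂ν
  map_add' x y := by
    rw [← integral_add (L1.integrable_coeFn x).integrableOn (L1.integrable_coeFn y).integrableOn]
    exact integral_congr_ae (ae_restrict_of_ae (Lp.coeFn_add x y))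
  map_smul' c x := by
    rw [RingHom.id_apply, ← integral_smul]
    exact integral_congr_ae (ae_restrict_of_ae (Lp.coeFn_smul c x))

theorem abs_setIntegralₗ_le {Y : Type*} [MeasurableSpace Y] (ν : Measure Y) (C : Set Y)
    (x : Lp ℝ 1 ν) : |setIntegralₗ ν C x| ≤ ‖x‖ := by
  rw [L1.norm_eq_integral_norm]
  refine (norm_integral_le_integral_norm (μ := ν.restrict C) x).trans ?_
  exact setIntegral_le_integral (L1.integrable_coeFn x).norm
    (Eventually.of_forall fun t => norm_nonneg _)

/-- The integral over a subset of `X` as a functional on `L¹`. -/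
noncomputable def setInt (μ : Measure X) (C : Set X) : L1 μ →ₗ[ℝ] ℝ :=
  setIntegralₗ μ.completion C

theorem abs_setInt_le (C : Set X) (x : L1 μ) : |setInt μ C x| ≤ ‖x‖ :=
  abs_setIntegralₗ_le _ _ _

theorem continuous_setInt (C : Set X) : Continuous (setInt μ C) :=
  ((setInt μ C).mkContinuous 1 fun x => by simpa using abs_setInt_le C x).continuous

theorem setInt_univ (x : L1 μ) :
    setInt μ Set.univ x = @integral (NullMeasurableSpace X μ) ℝ _ _ _ μ.completion x :=
  setIntegral_univ (μ := μ.completion) (f := x)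

theorem setInt_univ_koopman (e : invertibleTransformations μ) (x : L1 μ) :
    setInt μ Set.univ (koopman e x) = setInt μ Set.univ x := by
  rw [setInt_univ, setInt_univ]
  refine (integral_congr_ae (μ := μ.completion) (coeFn_koopman e x)).trans ?_
  have h := e.2.2.measurePreserving
  have h1 := integral_map h.measurable.aemeasurable (f := x) (by
    rw [h.map_eq]; exact (Lp.aestronglyMeasurable x))
  rw [h.map_eq] at h1
  exact h1.symm

/-- Apply `T⁻¹` to `T B ∩ C`. This lets an argument about the first set be repeated for the second.
-/
theorem measureInter_inv (T : TransformationGroup μ) {B C : Set X} (hB : NullMeasurableSet B μ)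
    (hC : NullMeasurableSet C μ) : measureInter C B T⁻¹ = measureInter B C T := by
  induction T using QuotientGroup.induction_on with | H e
  have he : NullMeasurableSet (e.1 '' B) μ := by
    rw [Equiv.image_eq_preimage_symm]; exact (e.2.2 B hB).1
  change μ ((e.1.symm '' C) ∩ B) = μ ((e.1 '' B) ∩ C)
  rw [← (e.2.1 _ (he.inter hC)).2, Set.preimage_inter, Equiv.preimage_image, Set.inter_comm]
  congr 2
  exact Equiv.image_eq_preimage_symm e.1.symm C

variable [IsProbabilityMeasure μ]

theorem setInt_indL1 {B C : Set X} (hB : NullMeasurableSet B μ) (hC : NullMeasurableSet C μ) :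
    setInt μ C (indL1 hB) = (μ (B ∩ C)).toReal := by
  refine (setIntegral_indicatorConstLp (X := NullMeasurableSpace X μ) hC hB
    (measure_ne_top _ _) (1 : ℝ)).trans ?_
  rw [smul_eq_mul, mul_one]
  exact congrArg ENNReal.toReal (completion_apply' μ _)

theorem rep_oneL1 (T : TransformationGroup μ) : rep T (oneL1 μ) = oneL1 μ := by
  induction T using QuotientGroup.induction_on with | H e
  have h : e.1 '' Set.univ = Set.univ := by simp
  rw [rep_mk, oneL1, koopman_indL1 e _ (by rw [h]; exact nullMeasurableSet_univ)]
  exact indL1_congr _ _ (by rw [h]; exact ae_eq_refl _)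

theorem edist_rep_indL1 (T S : TransformationGroup μ) {B : Set X} (hB : NullMeasurableSet B μ) :
    edist (rep T (indL1 hB)) (rep S (indL1 hB)) = measureSymmDiff B T S := by
  induction T using QuotientGroup.induction_on with | H e
  induction S using QuotientGroup.induction_on with | H f
  have he : NullMeasurableSet (e.1 '' B) μ := by
    rw [Equiv.image_eq_preimage_symm]; exact (e.2.2 B hB).1
  have hf : NullMeasurableSet (f.1 '' B) μ := by
    rw [Equiv.image_eq_preimage_symm]; exact (f.2.2 B hB).1
  rw [rep_mk, rep_mk, koopman_indL1 e hB he, koopman_indL1 f hB hf, edist_indL1]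
  rfl

theorem setInt_rep_indL1 (T : TransformationGroup μ) {B C : Set X} (hB : NullMeasurableSet B μ)
    (hC : NullMeasurableSet C μ) :
    setInt μ C (rep T (indL1 hB)) = (measureInter B C T).toReal := by
  induction T using QuotientGroup.induction_on with | H e
  have he : NullMeasurableSet (e.1 '' B) μ := by
    rw [Equiv.image_eq_preimage_symm]; exact (e.2.2 B hB).1
  rw [rep_mk, koopman_indL1 e hB he, setInt_indL1 he hC]
  rfl

end Representation
-- Pointwise limits of transformations are transformations.
section Limits

/-- A sequence of isometries converging on a total set converges pointwise to an isometry. -/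
theorem exists_linearIsometry_tendsto {E : Type*} [NormedAddCommGroup E] [NormedSpace ℝ E]
    [CompleteSpace E] (V : ℕ → E →ₗᵢ[ℝ] E) {s : Set E}
    (hs : ∀ K : Submodule ℝ E, IsClosed (K : Set E) → s ⊆ K → ∀ x, x ∈ K)
    (h : ∀ x ∈ s, CauchySeq fun n => V n x) :
    ∃ Q : E →ₗᵢ[ℝ] E, ∀ x, Tendsto (fun n => V n x) atTop (𝓝 (Q x)) := by
  let K : Submodule ℝ E :=
    { carrier := {x | CauchySeq fun n => V n x}
      zero_mem' := by simpa using cauchySeq_const (0 : E)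
      add_mem' := fun {x y} hx hy => by
        simp only [map_add, Set.mem_ofPred_eq]
        exact CauchySeq.add hx hy
      smul_mem' := fun c x hx => by
        simp only [map_smul, Set.mem_ofPred_eq]
        exact (uniformContinuous_const_smul c).comp_cauchySeq hx }
  have hK : IsClosed (K : Set E) := by
    -- An `ε / 3` argument: isometries are equicontinuous, so Cauchy behaviour passes to the
    -- closure.
    refine isClosed_of_closure_subset fun x hx => ?_
    change CauchySeq fun n => V n x
    rw [Metric.cauchySeq_iff']
    intro ε hε
    obtain ⟨y, hy, hxy⟩ := Metric.mem_closure_iff.1 hx (ε / 3) (by positivity)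
    obtain ⟨N, hN⟩ := Metric.cauchySeq_iff'.1 (show CauchySeq fun n => V n y from hy) (ε / 3)
      (by positivity)
    refine ⟨N, fun n hn => ?_⟩
    have h1 : dist (V n x) (V n y) = dist x y := (V n).isometry.dist_eq x y
    have h2 : dist (V N x) (V N y) = dist x y := (V N).isometry.dist_eq x y
    have h3 := hN n hn
    have h4 := dist_triangle4 (V n x) (V n y) (V N y) (V N x)
    rw [dist_comm (V N y)] at h4
    linarith
  have hc : ∀ x, CauchySeq fun n => V n x := hs K hK h
  choose Q hQ using fun x => cauchySeq_tendsto_of_complete (hc x)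
  refine ⟨⟨⟨⟨Q, fun x y => ?_⟩, fun c x => ?_⟩, fun x => ?_⟩, hQ⟩
  · refine tendsto_nhds_unique (hQ (x + y)) ?_
    simpa using (hQ x).add (hQ y)
  · refine tendsto_nhds_unique (hQ (c • x)) ?_
    simpa using (hQ x).const_smul c
  · exact tendsto_nhds_unique (hQ x).norm (by simp)

/-- Pointwise convergence of isometries may be combined with convergence of the arguments. -/
theorem tendsto_isometry_apply {E : Type*} [NormedAddCommGroup E] [NormedSpace ℝ E]
    {V : ℕ → E →ₗᵢ[ℝ] E} {y : E} {z : E} (hV : Tendsto (fun n => V n y) atTop (𝓝 z))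
    {x : ℕ → E} (hx : Tendsto x atTop (𝓝 y)) : Tendsto (fun n => V n (x n)) atTop (𝓝 z) := by
  refine tendsto_of_tendsto_of_dist hV ?_
  refine (tendsto_iff_dist_tendsto_zero.1 hx).congr fun n => ?_
  rw [(V n).isometry.dist_eq, dist_comm]

variable {X : Type*} [MeasurableSpace X] {μ : Measure X}

theorem L1.exists_subseq_tendsto_ae {x : ℕ → L1 μ} {y : L1 μ} (h : Tendsto x atTop (𝓝 y)) :
    ∃ ns : ℕ → ℕ, StrictMono ns ∧
      ∀ᵐ t ∂μ, Tendsto (fun n => (x (ns n) : X → ℝ) t) atTop (𝓝 ((y : X → ℝ) t)) :=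
  (tendstoInMeasure_of_tendsto_Lp h).exists_seq_tendsto_ae

theorem NullMeasurePreserving.of_measurePreserving {Y : Type*} [MeasurableSpace Y]
    {ν : Measure Y} {f : X → Y}
    (hf : @MeasurePreserving (NullMeasurableSpace X μ) Y _ _ f μ.completion ν) :
    NullMeasurePreserving f μ ν := by
  intro B hB
  have h1 : @NullMeasurableSet (NullMeasurableSpace X μ) _ (f ⁻¹' B) μ.completion :=
    hB.preimage hf.quasiMeasurePreserving
  exact ⟨h1.measurable_of_complete, (completion_apply' μ _).symm.trans (hf.measure_preimage hB)⟩

theorem NullMeasurePreserving.comp' {X Y Z : Type*} [MeasurableSpace X] [MeasurableSpace Y]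
    [MeasurableSpace Z] {f : X → Y} {g : Y → Z} {μ : Measure X} {ν : Measure Y} {ρ : Measure Z}
    (hg : NullMeasurePreserving g ν ρ) (hf : NullMeasurePreserving f μ ν) :
    NullMeasurePreserving (g ∘ f) μ ρ := fun B hB =>
  ⟨(hf _ (hg B hB).1).1, (hf _ (hg B hB).1).2.trans (hg B hB).2⟩

variable [IsProbabilityMeasure μ]

/-- Functions of the form `h ∘ f` are total in `L¹`. -/
theorem mem_of_isClosed_of_compL1 {f : X → unitInterval} {g : unitInterval → X}
    (hf : NullMeasurePreserving f μ volume) (hg : NullMeasurePreserving g volume μ)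
    (hgf : ∀ᵐ x ∂μ, g (f x) = x)
    (K : Submodule ℝ (L1 μ)) (hK : IsClosed (K : Set (L1 μ)))
    (h : ∀ u : C(unitInterval, ℝ), compL1 hf.measurePreserving_borel u ∈ K) (x : L1 μ) :
    x ∈ K := by
  have h1 : ∀ y : Lp ℝ 1 (volume : Measure unitInterval),
      Lp.compMeasurePreserving f hf.measurePreserving_borel y ∈ K := by
    intro y
    refine (ContinuousMap.toLp_denseRange ℝ (volume : Measure unitInterval) ℝ
      ENNReal.one_ne_top).induction_on (p := fun y =>
        Lp.compMeasurePreserving f hf.measurePreserving_borel y ∈ K) y ?_ h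
    exact hK.preimage (Lp.isometry_compMeasurePreserving hf.measurePreserving_borel).continuous
  refine mem_of_isClosed_of_indL1 K hK (fun B hB => ?_) x
  obtain ⟨D, -, hDm, hD⟩ := (hg B hB.nullMeasurableSet).1.exists_measurable_subset_ae_eq
  have h2 := h1 (indicatorConstLp 1 hDm (measure_ne_top _ _) 1)
  suffices h3 : indL1 hB.nullMeasurableSet = indL1 (hf _ hDm.nullMeasurableSet).1 by
    rw [h3]
    exact h2
  refine indL1_congr _ _ ?_
  have h3 : ∀ᵐ x ∂μ, f x ∈ D ↔ f x ∈ g ⁻¹' B :=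
    hf.measurePreserving_borel.quasiMeasurePreserving.ae (hD.mono fun t ht => iff_of_eq ht)
  filter_upwards [h3, hgf] with t h4 h5
  refine propext (Iff.trans ?_ h4.symm)
  rw [Set.mem_preimage, h5]
  rfl

/-- A pointwise limit of composition operators is a composition operator. -/
theorem IsLebesgueSpace.exists_comp_of_tendsto (hμ : IsLebesgueSpace μ)
    {e : ℕ → invertibleTransformations μ} {Q : L1 μ →ₗᵢ[ℝ] L1 μ}
    (hQ : ∀ x, Tendsto (fun n => koopman (e n) x) atTop (𝓝 (Q x))) :
    ∃ τ : X → X, NullMeasurePreserving τ μ μ ∧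
      ∀ x : L1 μ, (Q x : X → ℝ) =ᵐ[μ] fun t => (x : X → ℝ) (τ t) := by
  obtain ⟨f, g, hf, hg, hgf, hfg⟩ := hμ
  set φ := compL1 hf.measurePreserving_borel
  obtain ⟨ns, hns, hae⟩ := L1.exists_subseq_tendsto_ae (hQ (φ inclusionMap))
  -- The a.e. limit of `f ∘ (e n)⁻¹` along a subsequence. Clamping by `projIcc` makes it
  -- interval-valued everywhere and changes nothing almost everywhere.
  let F : X → unitInterval := fun t => Set.projIcc 0 1 zero_le_one ((Q (φ inclusionMap) : X → ℝ) t)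
  have hFm : @Measurable (NullMeasurableSpace X μ) _ _ _ F :=
    continuous_projIcc.measurable.comp (Lp.stronglyMeasurable (Q (φ inclusionMap))).measurable
  have hcoe : ∀ h : C(unitInterval, ℝ), ∀ᵐ t ∂μ, ∀ n,
      (koopman (e n) (φ h) : X → ℝ) t = h (f ((e n).1.symm t)) := by
    intro h
    refine ae_all_iff.2 fun n => ?_
    filter_upwards [coeFn_koopman (e n) (φ h),
      (e n).2.2.ae (coeFn_compL1 hf.measurePreserving_borel h)] with t h1 h2
    rw [h1, h2]
  have hFlim : ∀ᵐ t ∂μ, Tendsto (fun n => f ((e (ns n)).1.symm t)) atTop (𝓝 (F t)) := by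
    filter_upwards [hae, hcoe inclusionMap] with t h1 h2
    have h3 := (continuous_projIcc (a := (0 : ℝ)) (b := 1)
      (h := zero_le_one)).continuousAt.tendsto.comp h1
    refine h3.congr fun n => ?_
    rw [Function.comp_apply, h2]
    exact Set.projIcc_val zero_le_one _
  have hQφ : ∀ h : C(unitInterval, ℝ), (Q (φ h) : X → ℝ) =ᵐ[μ] fun t => h (F t) := by
    intro h
    -- A further subsequence of `ns`, so that `f ∘ (e n)⁻¹` still tends to `F` along it; the
    -- continuity of `h` then identifies the limit.
    obtain ⟨ms, hms, hae'⟩ := L1.exists_subseq_tendsto_ae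
      ((hQ (φ h)).comp hns.tendsto_atTop)
    filter_upwards [hae', hcoe h, hFlim] with t h1 h2 h3
    refine tendsto_nhds_unique h1 ?_
    have h4 := (h.continuous.continuousAt.tendsto.comp h3).comp hms.tendsto_atTop
    refine h4.congr fun n => ?_
    exact (h2 _).symm
  have hF : @MeasurePreserving (NullMeasurableSpace X μ) _ _ _ F μ.completion volume := by
    refine ⟨hFm, ?_⟩
    have : IsFiniteMeasure
        (Measure.map (α := NullMeasurableSpace X μ) F μ.completion) :=
      Measure.isFiniteMeasure_map _ _
    -- The law of `F` is tested on continuous functions, whose integrals are kept by every `koopman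
    -- (e n)` and hence by `Q`.
    refine ext_of_forall_integral_eq_of_IsFiniteMeasure fun u => ?_
    let h : C(unitInterval, ℝ) := u.toContinuousMap
    have h1 : setInt μ Set.univ (Q (φ h)) = setInt μ Set.univ (φ h) := by
      refine tendsto_nhds_unique (((continuous_setInt Set.univ).tendsto _).comp (hQ (φ h))) ?_
      refine tendsto_const_nhds.congr fun n => ?_
      exact (setInt_univ_koopman (e n) (φ h)).symm
    rw [setInt_univ, setInt_univ] at h1
    have h2 : ∀ {k : X → unitInterval}
        (_ : @Measurable (NullMeasurableSpace X μ) _ _ _ k) {y : L1 μ},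
        ((y : X → ℝ) =ᵐ[μ] fun t => h (k t)) →
        ∫ s, u s ∂(Measure.map (α := NullMeasurableSpace X μ) k μ.completion) =
          @integral (NullMeasurableSpace X μ) ℝ _ _ _ μ.completion y := by
      intro k hk y hy
      rw [integral_map hk.aemeasurable u.continuous.aestronglyMeasurable]
      exact (integral_congr_ae (μ := μ.completion) hy).symm
    rw [h2 hFm (hQφ h), h1, ← h2 hf.measurePreserving_borel.measurable
      (coeFn_compL1 hf.measurePreserving_borel h), hf.measurePreserving_borel.map_eq]
  have hF' := NullMeasurePreserving.of_measurePreserving hF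
  have hτ : NullMeasurePreserving (g ∘ F) μ μ := hg.comp' hF'
  refine ⟨g ∘ F, hτ, fun x => ?_⟩
  let R : L1 μ →ₗᵢ[ℝ] L1 μ := Lp.compMeasurePreservingₗᵢ ℝ (μ := μ.completion)
    (μb := μ.completion) _ hτ.measurePreserving
  have hR : ∀ y : L1 μ, (R y : X → ℝ) =ᵐ[μ] fun t => (y : X → ℝ) (g (F t)) := fun y =>
    Lp.coeFn_compMeasurePreserving y hτ.measurePreserving
  -- Both operators send `h ∘ f` to `h ∘ F`, the second because `f ∘ g = id` a.e., and such
  -- functions are total.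
  have hmem : x ∈ LinearMap.eqLocus Q.toLinearMap R.toLinearMap := by
    refine mem_of_isClosed_of_compL1 hf hg hgf _ (isClosed_eq Q.continuous R.continuous)
      (fun u => ?_) x
    change Q (φ u) = R (φ u)
    refine Lp.ext ?_
    refine (hQφ u).trans (EventuallyEq.trans ?_ (hR (φ u)).symm)
    filter_upwards [hτ.ae (coeFn_compL1 hf.measurePreserving_borel u),
      hF.quasiMeasurePreserving.ae hfg] with t h1 h2
    rw [Function.comp_apply] at h1
    rw [h1, h2]
  have hQR : Q x = R x := hmem
  rw [hQR]
  exact hR x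

/-- A pointwise limit of transformations and of their inverses, as operators on `L¹`, comes from a
transformation. -/
theorem IsLebesgueSpace.exists_rep_eq (hμ : IsLebesgueSpace μ) {T : ℕ → TransformationGroup μ}
    {P Q : L1 μ →ₗᵢ[ℝ] L1 μ}
    (hP : ∀ x, Tendsto (fun n => rep (T n) x) atTop (𝓝 (P x)))
    (hQ : ∀ x, Tendsto (fun n => rep (T n)⁻¹ x) atTop (𝓝 (Q x))) :
    ∃ S : TransformationGroup μ, ∀ x, rep S x = P x := by
  -- `rep` is by definition the composition operator of the representative `Quotient.out`, so `hP`
  -- applies as it stands.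
  obtain ⟨τ, hτ, hPτ⟩ := hμ.exists_comp_of_tendsto (e := fun n => Quotient.out (T n)) hP
  obtain ⟨σ, hσ, hQσ⟩ := hμ.exists_comp_of_tendsto
    (e := fun n => Quotient.out ((T n)⁻¹ : TransformationGroup μ)) hQ
  have hPQ : ∀ x, P (Q x) = x := fun x => by
    refine tendsto_nhds_unique (tendsto_isometry_apply (hP (Q x)) (hQ x)) ?_
    refine tendsto_const_nhds.congr fun n => ?_
    rw [← rep_mul, mul_inv_cancel, rep_one]
  have hQP : ∀ x, Q (P x) = x := fun x => by
    refine tendsto_nhds_unique (tendsto_isometry_apply (hQ (P x)) (hP x)) ?_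
    refine tendsto_const_nhds.congr fun n => ?_
    rw [rep_inv_rep]
  -- Evaluating `P (Q y) = y` at the coordinate `y` gives `f (σ (τ t)) = f t`, and `g` undoes `f`.
  have key : ∀ {P Q : L1 μ →ₗᵢ[ℝ] L1 μ} {τ σ : X → X}, NullMeasurePreserving τ μ μ →
      NullMeasurePreserving σ μ μ →
      (∀ x : L1 μ, (P x : X → ℝ) =ᵐ[μ] fun t => (x : X → ℝ) (τ t)) →
      (∀ x : L1 μ, (Q x : X → ℝ) =ᵐ[μ] fun t => (x : X → ℝ) (σ t)) →
      (∀ x, P (Q x) = x) → ∀ᵐ t ∂μ, σ (τ t) = t := by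
    intro P Q τ σ hτ hσ hP hQ hPQ
    obtain ⟨f, g, hf, -, hgf, -⟩ := hμ
    set y := compL1 hf.measurePreserving_borel inclusionMap
    have hy := coeFn_compL1 hf.measurePreserving_borel inclusionMap
    have h0 := hP (Q y)
    rw [hPQ] at h0
    filter_upwards [h0, hτ.ae (hQ y), hτ.ae (hσ.ae hy), hy, hgf, hτ.ae (hσ.ae hgf)]
      with t h1 h2 h3 h4 h5 h6
    rw [h2, h3, h4] at h1
    rw [← h6, ← Subtype.ext h1, h5]
  -- The operator of `e` composes with `e⁻¹`, so `τ` must be the inverse and `σ` the map.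
  obtain ⟨e, -, he⟩ := hμ.exists_invertibleTransformation hσ hτ
    (key hσ hτ hQσ hPτ hQP) (key hτ hσ hPτ hQσ hPQ)
  refine ⟨(e : TransformationGroup μ), fun x => ?_⟩
  rw [rep_mk]
  refine Lp.ext ?_
  refine (coeFn_koopman e x).trans (EventuallyEq.trans ?_ (hPτ x).symm)
  filter_upwards [he] with t ht
  rw [ht]

end Limits
-- Weighted sums of extended nonnegative reals.
section Sums

/-- Dominated convergence for weighted sums in `ℝ≥0∞`. -/
theorem tendsto_tsum_mul_zero {κ α : Type*} {l : Filter α} {w : κ → ℝ≥0∞} (hw : ∑' k, w k ≠ ∞)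
    {f : κ → α → ℝ≥0∞} {C : ℝ≥0∞} (hC : C ≠ ∞) (hf : ∀ k a, f k a ≤ C)
    (h : ∀ k, Tendsto (f k) l (𝓝 0)) : Tendsto (fun a => ∑' k, w k * f k a) l (𝓝 0) := by
  rw [ENNReal.tendsto_nhds_zero]
  intro ε hε
  have hε2 : 0 < ε / 2 := ENNReal.half_pos hε.ne'
  have h1 : Tendsto (fun s : Finset κ => (∑' k : { k // k ∉ s }, w k) * C) atTop (𝓝 0) := by
    simpa using ENNReal.Tendsto.mul_const (ENNReal.tendsto_tsum_compl_atTop_zero hw)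
      (Or.inr hC)
  obtain ⟨s, hs⟩ := (ENNReal.tendsto_nhds_zero.1 h1 (ε / 2) hε2).exists
  have h2 : Tendsto (fun a => ∑ k ∈ s, w k * f k a) l (𝓝 0) := by
    have := tendsto_finsetSum s fun k (_ : k ∈ s) =>
      ENNReal.Tendsto.const_mul (a := w k) (h k) (Or.inr (ENNReal.ne_top_of_tsum_ne_top hw k))
    simpa using this
  filter_upwards [ENNReal.tendsto_nhds_zero.1 h2 (ε / 2) hε2] with a ha
  have h3 : ∑' k : { k // k ∉ s }, w k * f k a ≤ ε / 2 := by
    refine le_trans ?_ hs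
    rw [← ENNReal.tsum_mul_right]
    exact ENNReal.tsum_le_tsum fun k => mul_le_mul_right (hf k a) _
  calc ∑' k, w k * f k a = ∑ k ∈ s, w k * f k a + ∑' k : { k // k ∉ s }, w k * f k a :=
        (ENNReal.sum_add_tsum_compl s fun k => w k * f k a).symm
    _ ≤ ε / 2 + ε / 2 := add_le_add ha h3
    _ = ε := ENNReal.add_halves ε

theorem tsum_half_pow_succ : ∑' i : ℕ, (1 / 2 : ℝ≥0∞) ^ (i + 1) = 1 := by
  rw [ENNReal.tsum_geometric_add_one, one_div, ENNReal.one_sub_inv_two, inv_inv,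
    ENNReal.inv_mul_cancel two_ne_zero ENNReal.ofNat_ne_top]

theorem tsum_half_pow_prod : ∑' p : ℕ × ℕ, (1 / 2 : ℝ≥0∞) ^ ((p.1 + 1) + (p.2 + 1)) = 1 := by
  rw [ENNReal.tsum_prod (f := fun i j => (1 / 2 : ℝ≥0∞) ^ ((i + 1) + (j + 1)))]
  simp_rw [pow_add _ (_ + 1) (_ + 1), ENNReal.tsum_mul_left, tsum_half_pow_succ, mul_one]
  exact tsum_half_pow_succ

end Sums

/-! ### Metric axioms, finiteness, and convergence criteria for `d` and `a`. -/

section Metric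

variable {X : Type*} [MeasurableSpace X] {μ : Measure X}

theorem measureInter_le (B C : Set X) (T : TransformationGroup μ) : measureInter B C T ≤ μ C := by
  induction T using QuotientGroup.induction_on with | H e
  exact measure_mono Set.inter_subset_right

/-- The matrix coefficient `μ (T B ∩ C)` as a real number. -/
noncomputable def coeff (B C : Set X) (T : TransformationGroup μ) : ℝ := (measureInter B C T).toReal

theorem transCorr_eq (A : ℕ → Set X) (T S : TransformationGroup μ) :
    transCorr A T S = ∑' p : ℕ × ℕ, (1 / 2 : ℝ≥0∞) ^ ((p.1 + 1) + (p.2 + 1)) *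
      edist (coeff (A p.1) (A p.2) T) (coeff (A p.1) (A p.2) S) := by
  rw [ENNReal.tsum_prod (f := fun i j => (1 / 2 : ℝ≥0∞) ^ ((i + 1) + (j + 1)) *
      edist (coeff (A i) (A j) T) (coeff (A i) (A j) S))]
  simp_rw [edist_dist, Real.dist_eq]
  rfl

/-- The distance from `T` to the coefficients of the mixing limit. -/
noncomputable def mixCorr (A : ℕ → Set X) (T : TransformationGroup μ) : ℝ≥0∞ :=
  ∑' p : ℕ × ℕ, (1 / 2 : ℝ≥0∞) ^ ((p.1 + 1) + (p.2 + 1)) *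
      edist (coeff (A p.1) (A p.2) T) ((μ (A p.1)).toReal * (μ (A p.2)).toReal)

/-- Two transformations that are both nearly mixing are close for `a`, however far apart for `d`.
This bounds the supremum outside a finite subset of the group. -/
theorem transCorr_le_mixCorr (A : ℕ → Set X) (T S : TransformationGroup μ) :
    transCorr A T S ≤ mixCorr A T + mixCorr A S := by
  rw [transCorr_eq, mixCorr, mixCorr, ← ENNReal.tsum_add]
  refine ENNReal.tsum_le_tsum fun p => ?_
  rw [← mul_add]
  exact mul_le_mul_right (edist_triangle_right _ _ _) _

theorem transCorr_self (A : ℕ → Set X) (T : TransformationGroup μ) : transCorr A T T = 0 := by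
  simp [transCorr_eq]

theorem transCorr_comm (A : ℕ → Set X) (T S : TransformationGroup μ) :
    transCorr A T S = transCorr A S T := by
  simp [transCorr_eq, edist_comm]

theorem transCorr_triangle (A : ℕ → Set X) (T S R : TransformationGroup μ) :
    transCorr A T R ≤ transCorr A T S + transCorr A S R := by
  rw [transCorr_eq, transCorr_eq, transCorr_eq, ← ENNReal.tsum_add]
  refine ENNReal.tsum_le_tsum fun p => ?_
  rw [← mul_add]
  exact mul_le_mul_right (edist_triangle _ _ _) _

theorem weight_ne_zero {G : Type*} (len : G → ℝ) (g : G) :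
    ENNReal.ofReal ((2 : ℝ) ^ (-len g)) ≠ 0 := by
  have : (0 : ℝ) < 2 ^ (-len g) := by positivity
  simpa using this

theorem tsum_weight_ne_top {G : Type*} {len : G → ℝ}
    (hsum : Summable fun g : G => (2 : ℝ) ^ (-len g)) :
    ∑' g : G, ENNReal.ofReal ((2 : ℝ) ^ (-len g)) ≠ ∞ := by
  rw [← ENNReal.ofReal_tsum_of_nonneg (fun g => by positivity) hsum]
  exact ENNReal.ofReal_ne_top

variable {G : Type*} [Group G] {len : G → ℝ}

theorem transCorr_le_leadDist (A : ℕ → Set X) (T S : G →* TransformationGroup μ) (g : G) :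
    transCorr A (T g) (S g) ≤ leadDist len A T S :=
  (le_iSup (fun g => transCorr A (T g) (S g)) g).trans le_add_self

theorem transDist_le_leadDist (A : ℕ → Set X) (T S : G →* TransformationGroup μ) (g : G) :
    ENNReal.ofReal ((2 : ℝ) ^ (-len g)) * transDist A (T g) (S g) ≤ leadDist len A T S :=
  (ENNReal.le_tsum (f := fun g => ENNReal.ofReal ((2 : ℝ) ^ (-len g)) * transDist A (T g) (S g))
    g).trans le_self_add

variable [IsProbabilityMeasure μ]

theorem coeff_mem_Icc (B C : Set X) (T : TransformationGroup μ) :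
    coeff B C T ∈ Set.Icc (0 : ℝ) 1 :=
  ⟨ENNReal.toReal_nonneg, ENNReal.toReal_le_of_le_ofReal zero_le_one (by
    simpa using (measureInter_le B C T).trans prob_le_one)⟩

theorem edist_le_one_of_mem_Icc {x y : ℝ} (hx : x ∈ Set.Icc (0 : ℝ) 1)
    (hy : y ∈ Set.Icc (0 : ℝ) 1) : edist x y ≤ 1 := by
  rw [edist_dist, ← ENNReal.ofReal_one]
  exact ENNReal.ofReal_le_ofReal (by simpa using Real.dist_le_of_mem_Icc hx hy)

theorem transCorr_le_one (A : ℕ → Set X) (T S : TransformationGroup μ) : transCorr A T S ≤ 1 := by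
  rw [transCorr_eq]
  refine le_trans ?_ tsum_half_pow_prod.le
  exact ENNReal.tsum_le_tsum fun p => mul_le_of_le_one_right' <|
    edist_le_one_of_mem_Icc (coeff_mem_Icc _ _ _) (coeff_mem_Icc _ _ _)

theorem coeff_eq_setInt {A : ℕ → Set X} (hA : IsTotalSequence μ A) (i j : ℕ)
    (T : TransformationGroup μ) : coeff (A i) (A j) T =
      setInt μ (A j) (rep T (indL1 (hA.measurableSet i).nullMeasurableSet)) :=
  (setInt_rep_indL1 T _ (hA.measurableSet j).nullMeasurableSet).symm

theorem tendsto_mixCorr {A : ℕ → Set X} {α : Type*} {l : Filter α}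
    {T : α → TransformationGroup μ}
    (h : ∀ i j, Tendsto (fun a => measureInter (A i) (A j) (T a)) l (𝓝 (μ (A i) * μ (A j)))) :
    Tendsto (fun a => mixCorr A (T a)) l (𝓝 0) := by
  refine tendsto_tsum_mul_zero (tsum_half_pow_prod.trans_ne ENNReal.one_ne_top)
    ENNReal.one_ne_top (fun p a => ?_) fun p => ?_
  · refine edist_le_one_of_mem_Icc (coeff_mem_Icc _ _ _) ⟨by positivity, ?_⟩
    exact mul_le_one₀ measureReal_le_one ENNReal.toReal_nonneg measureReal_le_one
  · rw [← tendsto_iff_edist_tendsto_0, ← ENNReal.toReal_mul]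
    exact (ENNReal.tendsto_toReal (by finiteness)).comp (h p.1 p.2)

theorem tendsto_transCorr {A : ℕ → Set X} (hA : IsTotalSequence μ A) {α : Type*} {l : Filter α}
    {T : α → TransformationGroup μ} {S : TransformationGroup μ}
    (h : ∀ i, Tendsto (fun a => rep (T a) (indL1 (hA.measurableSet i).nullMeasurableSet)) l
      (𝓝 (rep S (indL1 (hA.measurableSet i).nullMeasurableSet)))) :
    Tendsto (fun a => transCorr A (T a) S) l (𝓝 0) := by
  simp_rw [transCorr_eq]
  refine tendsto_tsum_mul_zero (tsum_half_pow_prod.trans_ne ENNReal.one_ne_top)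
    ENNReal.one_ne_top (fun p a => ?_) fun p => ?_
  · exact edist_le_one_of_mem_Icc (coeff_mem_Icc _ _ _) (coeff_mem_Icc _ _ _)
  · rw [← tendsto_iff_edist_tendsto_0]
    simp_rw [coeff_eq_setInt hA]
    exact ((continuous_setInt _).tendsto _).comp (h p.1)

theorem measureSymmDiff_le_one (B : Set X) (T S : TransformationGroup μ) :
    measureSymmDiff B T S ≤ 1 := by
  induction T using QuotientGroup.induction_on with | H e
  induction S using QuotientGroup.induction_on with | H f
  exact prob_le_one

theorem transDist_le (A : ℕ → Set X) (T S : TransformationGroup μ) : transDist A T S ≤ 2 := by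
  calc transDist A T S ≤ ∑' i : ℕ, (1 / 2 : ℝ≥0∞) ^ (i + 1) * 2 := by
        refine ENNReal.tsum_le_tsum fun i => mul_le_mul_right ?_ _
        rw [← one_add_one_eq_two]
        exact add_le_add (measureSymmDiff_le_one _ _ _) (measureSymmDiff_le_one _ _ _)
    _ = 2 := by rw [ENNReal.tsum_mul_right, tsum_half_pow_succ, one_mul]

theorem transDist_eq {A : ℕ → Set X} (hA : IsTotalSequence μ A) (T S : TransformationGroup μ) :
    transDist A T S = ∑' i : ℕ, (1 / 2 : ℝ≥0∞) ^ (i + 1) *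
      (edist (rep T (indL1 (hA.measurableSet i).nullMeasurableSet))
        (rep S (indL1 (hA.measurableSet i).nullMeasurableSet)) +
      edist (rep T⁻¹ (indL1 (hA.measurableSet i).nullMeasurableSet))
        (rep S⁻¹ (indL1 (hA.measurableSet i).nullMeasurableSet))) := by
  simp_rw [edist_rep_indL1]
  rfl

theorem transDist_self {A : ℕ → Set X} (hA : IsTotalSequence μ A) (T : TransformationGroup μ) :
    transDist A T T = 0 := by
  simp [transDist_eq hA]

theorem transDist_comm {A : ℕ → Set X} (hA : IsTotalSequence μ A) (T S : TransformationGroup μ) :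
    transDist A T S = transDist A S T := by
  simp [transDist_eq hA, edist_comm]

theorem transDist_triangle {A : ℕ → Set X} (hA : IsTotalSequence μ A)
    (T S R : TransformationGroup μ) :
    transDist A T R ≤ transDist A T S + transDist A S R := by
  rw [transDist_eq hA, transDist_eq hA, transDist_eq hA, ← ENNReal.tsum_add]
  refine ENNReal.tsum_le_tsum fun i => ?_
  rw [← mul_add]
  rw [add_add_add_comm]
  exact mul_le_mul_right (add_le_add (edist_triangle _ _ _) (edist_triangle _ _ _)) _

theorem tendsto_transDist {A : ℕ → Set X} (hA : IsTotalSequence μ A) {α : Type*} {l : Filter α}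
    {T : α → TransformationGroup μ} {S : TransformationGroup μ}
    (h : ∀ i, Tendsto (fun a => rep (T a) (indL1 (hA.measurableSet i).nullMeasurableSet)) l
      (𝓝 (rep S (indL1 (hA.measurableSet i).nullMeasurableSet))))
    (h' : ∀ i, Tendsto (fun a => rep (T a)⁻¹ (indL1 (hA.measurableSet i).nullMeasurableSet)) l
      (𝓝 (rep S⁻¹ (indL1 (hA.measurableSet i).nullMeasurableSet)))) :
    Tendsto (fun a => transDist A (T a) S) l (𝓝 0) := by
  simp_rw [transDist_eq hA]
  refine tendsto_tsum_mul_zero (tsum_half_pow_succ.trans_ne ENNReal.one_ne_top)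
    (ENNReal.ofNat_ne_top (n := 2)) (fun i a => ?_) fun i => ?_
  · rw [← one_add_one_eq_two, edist_rep_indL1, edist_rep_indL1]
    exact add_le_add (measureSymmDiff_le_one _ _ _) (measureSymmDiff_le_one _ _ _)
  · simpa using (tendsto_iff_edist_tendsto_0.1 (h i)).add (tendsto_iff_edist_tendsto_0.1 (h' i))

theorem edist_le_transDist {A : ℕ → Set X} (hA : IsTotalSequence μ A)
    (T S : TransformationGroup μ) (i : ℕ) :
    (1 / 2 : ℝ≥0∞) ^ (i + 1) * edist (rep T (indL1 (hA.measurableSet i).nullMeasurableSet))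
        (rep S (indL1 (hA.measurableSet i).nullMeasurableSet)) ≤ transDist A T S := by
  rw [transDist_eq hA]
  exact le_trans (mul_le_mul_right le_self_add _) (ENNReal.le_tsum i)

theorem IsLebesgueSpace.eq_of_transDist_eq_zero (hμ : IsLebesgueSpace μ) {A : ℕ → Set X}
    (hA : IsTotalSequence μ A) {T S : TransformationGroup μ} (h : transDist A T S = 0) :
    T = S := by
  refine hμ.rep_injective fun x => ?_
  refine hA.mem_of_isClosed (LinearMap.eqLocus (rep T).toLinearMap (rep S).toLinearMap)
    (isClosed_eq (rep T).continuous (rep S).continuous) ?_ (fun i => ?_) x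
  · exact (rep_oneL1 T).trans (rep_oneL1 S).symm
  · have h1 := edist_le_transDist hA T S i
    rw [h, nonpos_iff_eq_zero, mul_eq_zero] at h1
    exact edist_eq_zero.1 (h1.resolve_left (by simp))

theorem actionDist_ne_top (hsum : Summable fun g : G => (2 : ℝ) ^ (-len g)) (A : ℕ → Set X)
    (T S : G →* TransformationGroup μ) : actionDist len A T S ≠ ∞ := by
  refine ne_top_of_le_ne_top (ENNReal.mul_ne_top (tsum_weight_ne_top hsum)
    (ENNReal.ofNat_ne_top (n := 2))) ?_
  rw [← ENNReal.tsum_mul_right]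
  exact ENNReal.tsum_le_tsum fun g => mul_le_mul_right (transDist_le _ _ _) _

theorem leadDist_ne_top (hsum : Summable fun g : G => (2 : ℝ) ^ (-len g)) (A : ℕ → Set X)
    (T S : G →* TransformationGroup μ) : leadDist len A T S ≠ ∞ :=
  ENNReal.add_ne_top.2 ⟨actionDist_ne_top hsum A T S,
    ne_top_of_le_ne_top ENNReal.one_ne_top (iSup_le fun _ => transCorr_le_one _ _ _)⟩

theorem leadDist_self {A : ℕ → Set X} (hA : IsTotalSequence μ A)
    (T : G →* TransformationGroup μ) : leadDist len A T T = 0 := by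
  simp [leadDist, actionDist, transDist_self hA, transCorr_self]

theorem leadDist_comm {A : ℕ → Set X} (hA : IsTotalSequence μ A)
    (T S : G →* TransformationGroup μ) : leadDist len A T S = leadDist len A S T := by
  simp only [leadDist, actionDist, transDist_comm hA (T _), transCorr_comm A (T _)]

theorem leadDist_triangle {A : ℕ → Set X} (hA : IsTotalSequence μ A)
    (T S R : G →* TransformationGroup μ) :
    leadDist len A T R ≤ leadDist len A T S + leadDist len A S R := by
  rw [leadDist, leadDist, leadDist, add_add_add_comm]
  refine add_le_add ?_ (iSup_le fun g => ?_)
  · rw [actionDist, actionDist, actionDist, ← ENNReal.tsum_add]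
    refine ENNReal.tsum_le_tsum fun g => ?_
    rw [← mul_add]
    exact mul_le_mul_right (transDist_triangle hA _ _ _) _
  · exact (transCorr_triangle A _ (S g) _).trans (add_le_add
      (le_iSup (fun g => transCorr A (T g) (S g)) g) (le_iSup (fun g => transCorr A (S g) (R g)) g))

theorem IsLebesgueSpace.eq_of_leadDist_eq_zero (hμ : IsLebesgueSpace μ) {A : ℕ → Set X}
    (hA : IsTotalSequence μ A) {T S : G →* TransformationGroup μ}
    (h : leadDist len A T S = 0) : T = S := by
  ext1 g
  refine hμ.eq_of_transDist_eq_zero hA ?_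
  have h1 := transDist_le_leadDist (len := len) A T S g
  rw [h, nonpos_iff_eq_zero, mul_eq_zero] at h1
  exact h1.resolve_left (weight_ne_zero len g)

theorem tendsto_actionDist {A : ℕ → Set X} (hA : IsTotalSequence μ A)
    (hsum : Summable fun g : G => (2 : ℝ) ^ (-len g)) {α : Type*} {l : Filter α}
    {T : α → G →* TransformationGroup μ} {S : G →* TransformationGroup μ}
    (h : ∀ g i, Tendsto (fun a => rep (T a g) (indL1 (hA.measurableSet i).nullMeasurableSet)) l
      (𝓝 (rep (S g) (indL1 (hA.measurableSet i).nullMeasurableSet)))) :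
    Tendsto (fun a => actionDist len A (T a) S) l (𝓝 0) := by
  refine tendsto_tsum_mul_zero (tsum_weight_ne_top hsum) (ENNReal.ofNat_ne_top (n := 2))
    (fun g a => transDist_le _ _ _) fun g => tendsto_transDist hA (h g) fun i => ?_
  -- The inverse terms of `d` are covered by the hypothesis at `g⁻¹`.
  simp_rw [← map_inv]
  exact h g⁻¹ i

end Metric
-- Testing mixing on a total sequence; separability of `L¹`.
section Mixing

variable {X : Type*} [MeasurableSpace X] {μ : Measure X} [IsProbabilityMeasure μ]

/-- Pointwise convergence of functionals of norm at most one needs only be checked on the constant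
`1` and on the indicators of a total sequence. -/
theorem IsTotalSequence.tendsto_functional {A : ℕ → Set X} (hA : IsTotalSequence μ A)
    {α : Type*} {l : Filter α} {L : α → L1 μ →ₗ[ℝ] ℝ} {L₀ : L1 μ →ₗ[ℝ] ℝ}
    (hL : ∀ a x, |L a x| ≤ ‖x‖) (hL₀ : ∀ x, |L₀ x| ≤ ‖x‖)
    (h1 : Tendsto (fun a => L a (oneL1 μ)) l (𝓝 (L₀ (oneL1 μ))))
    (h : ∀ i, Tendsto (fun a => L a (indL1 (hA.measurableSet i).nullMeasurableSet)) l
      (𝓝 (L₀ (indL1 (hA.measurableSet i).nullMeasurableSet)))) (x : L1 μ) :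
    Tendsto (fun a => L a x) l (𝓝 (L₀ x)) := by
  let K : Submodule ℝ (L1 μ) :=
    { carrier := {x | Tendsto (fun a => L a x) l (𝓝 (L₀ x))}
      zero_mem' := by simpa using tendsto_const_nhds
      add_mem' := fun {x y} hx hy => by
        simp only [map_add, Set.mem_ofPred_eq]
        exact Tendsto.add hx hy
      smul_mem' := fun c x hx => by
        simp only [map_smul, Set.mem_ofPred_eq]
        exact Tendsto.const_smul hx c }
  refine hA.mem_of_isClosed K (isClosed_of_closure_subset fun x hx => ?_) h1 h x
  change Tendsto (fun a => L a x) l (𝓝 (L₀ x))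
  rw [Metric.tendsto_nhds]
  intro ε hε
  obtain ⟨y, hy, hxy⟩ := Metric.mem_closure_iff.1 hx (ε / 3) (by positivity)
  have hy' : Tendsto (fun a => L a y) l (𝓝 (L₀ y)) := hy
  filter_upwards [Metric.tendsto_nhds.1 hy' (ε / 3) (by positivity)] with a ha
  have h2 : dist (L a x) (L a y) ≤ dist x y := by
    rw [Real.dist_eq, ← map_sub, dist_eq_norm]
    exact hL a _
  have h3 : dist (L₀ x) (L₀ y) ≤ dist x y := by
    rw [Real.dist_eq, ← map_sub, dist_eq_norm]
    exact hL₀ _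
  have h4 := dist_triangle4 (L a x) (L a y) (L₀ y) (L₀ x)
  rw [dist_comm (L₀ y)] at h4
  linarith

theorem setInt_oneL1 {C : Set X} (hC : NullMeasurableSet C μ) :
    setInt μ C (oneL1 μ) = (μ C).toReal := by
  rw [oneL1, setInt_indL1 nullMeasurableSet_univ hC, Set.univ_inter]

/-- Mixing needs only be checked on the members of a total sequence. -/
theorem IsTotalSequence.tendsto_measureInter {A : ℕ → Set X} (hA : IsTotalSequence μ A)
    {α : Type*} {l : Filter α} {T : α → TransformationGroup μ}
    (h : ∀ i j, Tendsto (fun a => coeff (A i) (A j) (T a)) l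
      (𝓝 ((μ (A i)).toReal * (μ (A j)).toReal)))
    {B C : Set X} (hB : NullMeasurableSet B μ) (hC : NullMeasurableSet C μ) :
    Tendsto (fun a => measureInter B C (T a)) l (𝓝 (μ B * μ C)) := by
  have hle : ∀ (D : Set X) (x : L1 μ), |((μ D).toReal • setInt μ Set.univ) x| ≤ ‖x‖ := by
    intro D x
    rw [LinearMap.smul_apply, smul_eq_mul, abs_mul, abs_of_nonneg ENNReal.toReal_nonneg]
    exact (mul_le_of_le_one_left (abs_nonneg _) measureReal_le_one).trans (abs_setInt_le _ x)
  have hle' : ∀ (D : Set X) (S : TransformationGroup μ) (x : L1 μ),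
      |(setInt μ D ∘ₗ (rep S).toLinearMap) x| ≤ ‖x‖ := fun D S x =>
    (abs_setInt_le D _).trans_eq ((rep S).norm_map x)
  have hlim : ∀ (D D' : Set X) (hD' : NullMeasurableSet D' μ),
      ((μ D).toReal • setInt μ Set.univ) (indL1 hD') = (μ D').toReal * (μ D).toReal := by
    intro D D' hD'
    rw [LinearMap.smul_apply, setInt_indL1 hD' nullMeasurableSet_univ, Set.inter_univ,
      smul_eq_mul, mul_comm]
  have hone : ∀ (D : Set X) (_ : NullMeasurableSet D μ) (S : TransformationGroup μ),
      (setInt μ D ∘ₗ (rep S).toLinearMap) (oneL1 μ) =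
        ((μ D).toReal • setInt μ Set.univ) (oneL1 μ) := by
    intro D hD S
    rw [oneL1, hlim, measure_univ, ENNReal.toReal_one, one_mul, ← setInt_oneL1 hD]
    exact congrArg _ (rep_oneL1 S)
  -- Totality is used twice: here it frees the first set while the second stays `A j`.
  have hstep : ∀ j, Tendsto (fun a => coeff B (A j) (T a)) l
      (𝓝 ((μ B).toReal * (μ (A j)).toReal)) := by
    intro j
    have hj := (hA.measurableSet j).nullMeasurableSet (μ := μ)
    have h1 := hA.tendsto_functional (l := l)
      (L := fun a => setInt μ (A j) ∘ₗ (rep (T a)).toLinearMap)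
      (L₀ := (μ (A j)).toReal • setInt μ Set.univ) (fun a => hle' _ _) (hle _) (by
        simp only [hone _ hj]
        exact tendsto_const_nhds) (fun i => by
        rw [hlim]
        exact (h i j).congr fun a => coeff_eq_setInt hA i j (T a)) (indL1 hB)
    rw [hlim] at h1
    exact h1.congr fun a => setInt_rep_indL1 (T a) hB hj
  -- Passing to inverses swaps the two sets, so the same argument frees the second one.
  have h2 := hA.tendsto_functional (l := l)
    (L := fun a => setInt μ B ∘ₗ (rep (T a)⁻¹).toLinearMap)
    (L₀ := (μ B).toReal • setInt μ Set.univ) (fun a => hle' _ _) (hle _) (by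
      simp only [hone _ hB]
      exact tendsto_const_nhds) (fun j => by
      have hj := (hA.measurableSet j).nullMeasurableSet (μ := μ)
      rw [hlim, mul_comm]
      refine (hstep j).congr fun a => ?_
      rw [coeff, ← measureInter_inv (T a) hB hj]
      exact (setInt_rep_indL1 (T a)⁻¹ hj hB).symm) (indL1 hC)
  rw [hlim, mul_comm, ← ENNReal.toReal_mul] at h2
  rw [← ENNReal.tendsto_toReal_iff (fun a => ne_top_of_le_ne_top (measure_ne_top μ C)
    (measureInter_le _ _ _)) (by finiteness)]
  refine h2.congr fun a => ?_
  rw [← measureInter_inv (T a) hB hC]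
  exact setInt_rep_indL1 (T a)⁻¹ hC hB

theorem IsTotalSequence.secondCountableTopology_L1 {A : ℕ → Set X} (hA : IsTotalSequence μ A) :
    SecondCountableTopology (L1 μ) := by
  set s : Set (L1 μ) :=
    insert (oneL1 μ) (Set.range fun i => indL1 (hA.measurableSet i).nullMeasurableSet)
  have hs : s.Countable := (Set.countable_range _).insert _
  have h : TopologicalSpace.IsSeparable (Set.univ : Set (L1 μ)) := by
    refine (hs.isSeparable.span (R := ℝ)).closure.mono fun x _ => ?_
    refine hA.mem_of_isClosed (Submodule.span ℝ s).topologicalClosure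
      (Submodule.isClosed_topologicalClosure _) ?_ (fun i => ?_) x
    · exact Submodule.le_topologicalClosure _ (Submodule.subset_span (Set.mem_insert _ _))
    · exact Submodule.le_topologicalClosure _
        (Submodule.subset_span (Set.mem_insert_of_mem _ ⟨i, rfl⟩))
  have := TopologicalSpace.isSeparable_univ_iff.1 h
  exact UniformSpace.secondCountable_of_separable _

end Mixing

/-! ### Limits of Cauchy sequences of mixing actions. -/

section Complete

variable {X : Type*} [MeasurableSpace X] {μ : Measure X} [IsProbabilityMeasure μ]
  {G : Type*} [Group G] {len : G → ℝ}

theorem cauchySeq_rep_of_leadDist {A : ℕ → Set X} (hA : IsTotalSequence μ A)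
    {T : ℕ → G →* TransformationGroup μ}
    (hT : ∀ ε > 0, ∃ N, ∀ m ≥ N, ∀ n ≥ N, leadDist len A (T m) (T n) < ε) (g : G) (i : ℕ) :
    CauchySeq fun n => rep (T n g) (indL1 (hA.measurableSet i).nullMeasurableSet) := by
  rw [EMetric.cauchySeq_iff]
  intro ε hε
  -- The total weight of the `i`-th term at `g` in the lead metric.
  set c := ENNReal.ofReal ((2 : ℝ) ^ (-len g)) * (1 / 2 : ℝ≥0∞) ^ (i + 1)
  have hc : c ≠ 0 := mul_ne_zero (weight_ne_zero len g) (by simp)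
  obtain ⟨N, hN⟩ := hT (c * ε) (pos_iff_ne_zero.2 (mul_ne_zero hc hε.ne'))
  refine ⟨N, fun m hm n hn => lt_of_mul_lt_mul_left' (a := c) (lt_of_le_of_lt ?_ (hN m hm n hn))⟩
  rw [mul_assoc]
  exact (mul_le_mul_right (edist_le_transDist hA _ _ i) _).trans (transDist_le_leadDist A _ _ g)

theorem IsLebesgueSpace.exists_tendsto_rep (hμ : IsLebesgueSpace μ) {A : ℕ → Set X}
    (hA : IsTotalSequence μ A) {T : ℕ → G →* TransformationGroup μ}
    (hT : ∀ g i, CauchySeq fun n =>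
      rep (T n g) (indL1 (hA.measurableSet i).nullMeasurableSet)) :
    ∃ S : G →* TransformationGroup μ,
      ∀ g x, Tendsto (fun n => rep (T n g) x) atTop (𝓝 (rep (S g) x)) := by
  have hP : ∀ g, ∃ P : L1 μ →ₗᵢ[ℝ] L1 μ, ∀ x,
      Tendsto (fun n => rep (T n g) x) atTop (𝓝 (P x)) := by
    intro g
    refine exists_linearIsometry_tendsto (fun n => rep (T n g)) (s := insert (oneL1 μ)
      (Set.range fun i => indL1 (hA.measurableSet i).nullMeasurableSet)) (fun K hK hs x => ?_) ?_
    · exact hA.mem_of_isClosed K hK (hs (Set.mem_insert _ _))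
        (fun i => hs (Set.mem_insert_of_mem _ ⟨i, rfl⟩)) x
    · rintro x (rfl | ⟨i, rfl⟩)
      · simp only [rep_oneL1]
        exact cauchySeq_const _
      · exact hT g i
  choose P hP using hP
  have hS : ∀ g, ∃ S : TransformationGroup μ, ∀ x, rep S x = P g x := fun g =>
    -- Since each `T n` is a homomorphism, the limit at `g⁻¹` is the limit of the inverses at `g`.
    hμ.exists_rep_eq (hP g) (Q := P g⁻¹) (by simpa only [map_inv] using hP g⁻¹)
  choose S hS using hS
  refine ⟨MonoidHom.mk' S fun g h => hμ.rep_injective fun x => ?_, fun g x => ?_⟩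
  · rw [rep_mul, hS, hS, hS]
    refine tendsto_nhds_unique (hP (g * h) x) ?_
    simp only [map_mul, rep_mul]
    exact tendsto_isometry_apply (hP g (P h x)) (hP h x)
  · change Tendsto _ _ (𝓝 (rep (S g) x))
    rw [hS]
    exact hP g x

theorem tendsto_leadDist_of_cauchy {A : ℕ → Set X} (hA : IsTotalSequence μ A)
    (hsum : Summable fun g : G => (2 : ℝ) ^ (-len g))
    {T : ℕ → G →* TransformationGroup μ} {S : G →* TransformationGroup μ}
    (hT : ∀ ε > 0, ∃ N, ∀ m ≥ N, ∀ n ≥ N, leadDist len A (T m) (T n) < ε)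
    (hS : ∀ g x, Tendsto (fun n => rep (T n g) x) atTop (𝓝 (rep (S g) x))) :
    Tendsto (fun n => leadDist len A (T n) S) atTop (𝓝 0) := by
  have h1 : Tendsto (fun n => ⨆ g, transCorr A (T n g) (S g)) atTop (𝓝 0) := by
    rw [ENNReal.tendsto_nhds_zero]
    intro ε hε
    obtain ⟨N, hN⟩ := hT ε hε
    filter_upwards [eventually_ge_atTop N] with n hn
    refine iSup_le fun g => ?_
    -- `N` does not depend on `g`. Letting `m` tend to infinity for each `g` separately therefore
    -- gives a bound uniform in `g`.
    have h2 : Tendsto (fun m => ε + transCorr A (T m g) (S g)) atTop (𝓝 (ε + 0)) :=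
      tendsto_const_nhds.add (tendsto_transCorr hA fun i => hS g _)
    rw [add_zero] at h2
    refine ge_of_tendsto h2 ?_
    filter_upwards [eventually_ge_atTop N] with m hm
    refine (transCorr_triangle A _ (T m g) _).trans (add_le_add_left ?_ _)
    exact (transCorr_le_leadDist A _ _ g).trans (hN n hn m hm).le
  have h3 := (tendsto_actionDist hA hsum fun g i => hS g _).add h1
  rw [add_zero] at h3
  exact h3

theorem isMixing_of_tendsto_leadDist {A : ℕ → Set X} (hA : IsTotalSequence μ A)
    {T : ℕ → G →* TransformationGroup μ} {S : G →* TransformationGroup μ}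
    (hT : ∀ n, IsMixing len (T n))
    (hS : Tendsto (fun n => leadDist len A (T n) S) atTop (𝓝 0)) : IsMixing len S := by
  intro B C hB hC
  refine hA.tendsto_measureInter (fun i j => ?_) hB.nullMeasurableSet hC.nullMeasurableSet
  rw [EMetric.tendsto_nhds]
  intro ε hε
  have hε2 : 0 < ε / 2 := ENNReal.half_pos hε.ne'
  set c := (1 / 2 : ℝ≥0∞) ^ ((i + 1) + (j + 1))
  have hc : c ≠ 0 := by simp [c]
  have hc' : c ≠ ∞ := by simp [c]
  -- Thanks to the supremum, a single `n` serves all `g`; mixing of `T n` then carries over to `S`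
  -- up to `ε / 2`.
  obtain ⟨n, hn⟩ := (hS.eventually_lt_const (pos_iff_ne_zero.2 (mul_ne_zero hc hε2.ne'))).exists
  have hmix : Tendsto (fun g => coeff (A i) (A j) (T n g)) (comap len atTop)
      (𝓝 ((μ (A i)).toReal * (μ (A j)).toReal)) := by
    rw [← ENNReal.toReal_mul]
    exact (ENNReal.tendsto_toReal (by finiteness)).comp
      (hT n _ _ (hA.measurableSet i) (hA.measurableSet j))
  filter_upwards [EMetric.tendsto_nhds.1 hmix (ε / 2) hε2] with g hg
  have h1 : edist (coeff (A i) (A j) (S g)) (coeff (A i) (A j) (T n g)) < ε / 2 := by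
    refine lt_of_mul_lt_mul_left' (a := c) (lt_of_le_of_lt ?_ hn)
    refine le_trans ?_ (transCorr_le_leadDist A _ _ g)
    rw [transCorr_eq, edist_comm]
    exact ENNReal.le_tsum (f := fun p : ℕ × ℕ => (1 / 2 : ℝ≥0∞) ^ ((p.1 + 1) + (p.2 + 1)) *
      edist (coeff (A p.1) (A p.2) (T n g)) (coeff (A p.1) (A p.2) (S g))) (i, j)
  calc _ ≤ _ := edist_triangle _ (coeff (A i) (A j) (T n g)) _
    _ < ε / 2 + ε / 2 := ENNReal.add_lt_add h1 hg
    _ = ε := ENNReal.add_halves ε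

end Complete

/-! ### A countable dense set of mixing actions. -/

section Separable

variable {X : Type*} [MeasurableSpace X] {μ : Measure X} [IsProbabilityMeasure μ]

/-- Summability leaves only finitely many `g` below any length, so failure of near-mixing is
confined to a finite set. -/
theorem tendsto_len_cofinite {G : Type*} {len : G → ℝ}
    (hsum : Summable fun g : G => (2 : ℝ) ^ (-len g)) : Tendsto len cofinite atTop := by
  rw [tendsto_atTop]
  intro b
  filter_upwards [hsum.tendsto_cofinite_zero.eventually_lt_const
    (show (0 : ℝ) < 2 ^ (-b) by positivity)] with g hg
  rw [Real.rpow_lt_rpow_left_iff one_lt_two] at hg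
  linarith

variable {G : Type*} [Group G] {len : G → ℝ}

theorem IsMixing.exists_finset_mixCorr_le (hsum : Summable fun g : G => (2 : ℝ) ^ (-len g))
    {A : ℕ → Set X} (hA : IsTotalSequence μ A) {T : G →* TransformationGroup μ}
    (hT : IsMixing len T) {ε : ℝ≥0∞} (hε : 0 < ε) :
    ∃ K : Finset G, ∀ g ∉ K, mixCorr A (T g) ≤ ε := by
  have h : Tendsto (fun g => mixCorr A (T g)) cofinite (𝓝 0) :=
    tendsto_mixCorr fun i j => (hT _ _ (hA.measurableSet i) (hA.measurableSet j)).mono_left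
      (tendsto_iff_comap.1 (tendsto_len_cofinite hsum))
  have hfin := ENNReal.tendsto_nhds_zero.1 h ε hε
  rw [eventually_cofinite] at hfin
  refine ⟨hfin.toFinset, fun g hg => ?_⟩
  by_contra hcon
  exact hg (hfin.mem_toFinset.2 hcon)

/-- One `ε` pays for `d`. The other two bound the supremum: on the finite `K` by pointwise
approximation, off `K` because both actions are `ε`-close to the product values. -/
theorem exists_countable_leadDist_le [Countable G]
    (hsum : Summable fun g : G => (2 : ℝ) ^ (-len g))
    {A : ℕ → Set X} (hA : IsTotalSequence μ A) {ε : ℝ≥0∞} (hε : 0 < ε) (K : Finset G)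
    (M : Set (G →* TransformationGroup μ)) (hM : ∀ T ∈ M, ∀ g ∉ K, mixCorr A (T g) ≤ ε) :
    ∃ t ⊆ M, t.Countable ∧ ∀ T ∈ M, ∃ S ∈ t, leadDist len A T S ≤ ε + (ε + ε) := by
  have := hA.secondCountableTopology_L1
  let v : M → G → ℕ → L1 μ := fun T g i =>
    rep (T.1 g) (indL1 (hA.measurableSet i).nullMeasurableSet)
  -- The pointwise `L¹` topology, induced from a countable product of second countable spaces. A
  -- dense set is chosen inside `M` itself so that `hM` also holds for the approximants.
  let _ : TopologicalSpace M := TopologicalSpace.induced v inferInstance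
  have hv : Continuous v := continuous_induced_dom
  have hsc : SecondCountableTopology M := TopologicalSpace.secondCountableTopology_induced M _ v
  obtain ⟨t, htc, htd⟩ := TopologicalSpace.exists_countable_dense M
  refine ⟨Subtype.val '' t, by rintro _ ⟨T, -, rfl⟩; exact T.2, htc.image _, fun T hT => ?_⟩
  have hlim : ∀ g i, Tendsto
      (fun S : M => rep (S.1 g) (indL1 (hA.measurableSet i).nullMeasurableSet)) (𝓝 ⟨T, hT⟩)
      (𝓝 (rep (T g) (indL1 (hA.measurableSet i).nullMeasurableSet))) := fun g i =>
    ((continuous_apply_apply g i).comp hv).tendsto ⟨T, hT⟩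
  have h1 := ENNReal.tendsto_nhds_zero.1 (tendsto_actionDist hA hsum hlim) ε hε
  have h2 : ∀ᶠ S : M in 𝓝 ⟨T, hT⟩, ∀ g ∈ K, transCorr A (S.1 g) (T g) ≤ ε :=
    (eventually_all_finset K).2 fun g _ =>
      ENNReal.tendsto_nhds_zero.1 (tendsto_transCorr hA (hlim g)) ε hε
  obtain ⟨S, hSt, hS1, hS2⟩ := htd.inter_nhds_nonempty (h1.and h2)
  refine ⟨S, ⟨S, hSt, rfl⟩, ?_⟩
  rw [leadDist_comm hA]
  refine add_le_add hS1 (iSup_le fun g => ?_)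
  by_cases hg : g ∈ K
  · exact (hS2 g hg).trans le_self_add
  · exact (transCorr_le_mixCorr A _ _).trans (add_le_add (hM S S.2 g hg) (hM T hT g hg))

theorem exists_countable_dense_mixing [Countable G]
    (hsum : Summable fun g : G => (2 : ℝ) ^ (-len g))
    {A : ℕ → Set X} (hA : IsTotalSequence μ A) {ε : ℝ≥0∞} (hε : 0 < ε) :
    ∃ t : Set (MixingAction μ len), t.Countable ∧
      ∀ T : MixingAction μ len, ∃ S ∈ t, leadDist len A T.1 S.1 ≤ ε := by
  have hε3 : 0 < ε / 3 := ENNReal.div_pos hε.ne' ENNReal.ofNat_ne_top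
  -- Mixing is part of the class attached to `K`, so the approximants are themselves mixing actions.
  choose t ht htc htd using fun K : Finset G => exists_countable_leadDist_le hsum hA hε3 K
    {T | IsMixing len T ∧ ∀ g ∉ K, mixCorr A (T g) ≤ ε / 3} fun T hT => hT.2
  refine ⟨Subtype.val ⁻¹' ⋃ K, t K,
    (Set.countable_iUnion htc).preimage Subtype.val_injective, fun T => ?_⟩
  obtain ⟨K, hK⟩ := T.2.exists_finset_mixCorr_le hsum hA hε3
  obtain ⟨S, hS, hTS⟩ := htd K T.1 ⟨T.2, hK⟩
  refine ⟨⟨S, (ht K hS).1⟩, Set.mem_iUnion.2 ⟨K, hS⟩, hTS.trans_eq ?_⟩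
  rw [← add_assoc, ENNReal.add_thirds]

end Separable

end LeadMetric

open LeadMetric

theorem mainTheorem1 {X : Type*} [MeasurableSpace X] (μ : Measure X)
    (hμ : LeadMetric.IsLebesgueSpace μ)
    (A : ℕ → Set X) (hA : LeadMetric.IsTotalSequence μ A)
    {G : Type*} [Group G] [Countable G]
    (len : G → ℝ) (hpos : ∀ g, 0 < len g)
    (hsum : Summable fun g : G => (2 : ℝ) ^ (-len g)) :
    ∃ _ : MetricSpace (LeadMetric.MixingAction μ len),
      (∀ T S : LeadMetric.MixingAction μ len,
        ENNReal.ofReal (dist T S) = LeadMetric.leadDist len A T.1 S.1) ∧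
      CompleteSpace (LeadMetric.MixingAction μ len) ∧
      TopologicalSpace.SeparableSpace (LeadMetric.MixingAction μ len) := by
  have := hμ.isProbabilityMeasure
  let E : EMetricSpace (MixingAction μ len) :=
    { edist := fun T S => leadDist len A T.1 S.1
      edist_self := fun T => leadDist_self hA T.1
      edist_comm := fun T S => leadDist_comm hA T.1 S.1
      edist_triangle := fun T S R => leadDist_triangle hA T.1 S.1 R.1
      eq_of_edist_eq_zero := fun {T S} h => Subtype.ext (hμ.eq_of_leadDist_eq_zero hA h) }
  -- Built from `E`, so that its `edist` is still `leadDist` by definition.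
  let D : MetricSpace (MixingAction μ len) :=
    EMetricSpace.toMetricSpace fun T S => leadDist_ne_top hsum A T.1 S.1
  refine ⟨D, ?_, ?_, ?_⟩
  · intro T S
    rw [← edist_dist]
    rfl
  · refine EMetric.complete_of_cauchySeq_tendsto fun T hT => ?_
    have hT' := EMetric.cauchySeq_iff.1 hT
    obtain ⟨S, hS⟩ := hμ.exists_tendsto_rep hA (T := fun n => (T n).1)
      (cauchySeq_rep_of_leadDist hA hT')
    have hlim := tendsto_leadDist_of_cauchy hA hsum hT' hS
    refine ⟨⟨S, isMixing_of_tendsto_leadDist hA (fun n => (T n).2) hlim⟩, ?_⟩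
    exact tendsto_iff_edist_tendsto_0.2 hlim
  · have : SecondCountableTopology (MixingAction μ len) := by
      refine EMetric.secondCountable_of_almost_dense_set fun ε hε => ?_
      obtain ⟨t, htc, ht⟩ := exists_countable_dense_mixing (len := len) hsum hA hε
      refine ⟨t, htc, Set.eq_univ_of_forall fun T => ?_⟩
      obtain ⟨S, hS, hTS⟩ := ht T
      exact Set.mem_biUnion hS hTS
    infer_instance
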